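/- **Notation.** $\|\cdot\|_2$ is the spectral norm, $M^\dagger$ the Moore–Penrose pseudo-inverse, and $\kappa_2(M)=\|M\|_2\|M^\dagger\|_2$ for a matrix $M$ with linearly independent columns. For $u>0$ (the unit round-off) and an integer $k$ with $ku<1$ put $\gamma_k=ku/(1-ku)$. Floating-point arithmetic follows the standard model: every elementary operation ($+,-,\times,/,\sqrt{\cdot}$) with exact result $x$ returns some value $x(1+\delta)$ with $|\delta|\le u$; sums may be accumulated in any order. **Theorem.** There is a universal integer constant $c\ge 1$ such that, with $\tilde\gamma_{sn}=\gamma_{csn}$, the following holds. Let $m>s>n$ and $u>0$ with $mu<1$ and $csnu<1$. Let $A\in\mathbb{R}^{m\times n}$ have linearly independent columns, let $S\in\mathbb{R}^{s\times m}$ have linearly independent rows, and suppose that $SA$ has full column rank. Let $A=Q_AR_A$ be an economized QR factorization ($Q_A\in\mathbb{R}^{m\times n}$ with orthonormal columns, $R_A\in\mathbb{R}^{n\times n}$ upper triangular), and put $$C_1=\sqrt{sn}\,\gamma_m+\sqrt n\,\tilde\gamma_{sn}\,(1+\sqrt{sn}\,\gamma_m),\qquad k(S)=\|S\|_2\,\|(SQ_A)^\dagger\|_2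 .$$ Assume that $$\kappa_2(SQ_A)<49,\qquad n^2u<\tfrac1{201},\qquad \tfrac mn+\sqrt n>200,\qquad \kappa_2(A)<\frac{1}{3\,C_1\,k(S)} .$$ In floating-point arithmetic, compute the product $\hat B$ of $S$ and $A$ by the standard algorithm; then the triangular factor $\hat R\in\mathbb{R}^{n\times n}$ of $\hat B$ by Householder QR (reflectors $I-\beta vv^T$ with $v=x+\tau e_1$, $\tau=\operatorname{sign}(x_1)\|x\|_2$, $\beta=1/(\tau v_1)$); then $\hat Y\in\mathbb{R}^{m\times n}$, the computed $A\hat R^{-1}$, by solving $\hat R^Ty_i=a_i$ with forward substitution for every row $a_i^T$ of $A$. Then, whatever the rounding errors, $\hat R$ has non-zero diagonal entries (so that the substitution does not break down), $\hat Y$ has linearly independent columns, and $$\kappa_2(\hat Y)\le 4\,\kappa_2(SQ_A)+1 .$$ Moreover, under these assumptions, $C_1\le K\,(\sqrt{sn}\,m+sn^{3/2})\,u$ with a universal constant $K$. -/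

import Mathlib

open Matrix

namespace SketchApply

noncomputable section

/-! ### Spectral norm, pseudo-inverse, condition number -/

open scoped Matrix.Norms.L2Operator in
/-- The spectral norm `‖M‖₂`, the operator norm between Euclidean spaces. -/
def specNorm {m n : ℕ} (M : Matrix (Fin m) (Fin n) ℝ) : ℝ := ‖M‖

/-- The Moore–Penrose pseudo-inverse `M† = (MᵀM)⁻¹Mᵀ` of a matrix with linearly
independent columns. -/
def pinv {m n : ℕ} (M : Matrix (Fin m) (Fin n) ℝ) : Matrix (Fin n) (Fin m) ℝ :=
  (Mᵀ * M)⁻¹ * Mᵀ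

/-- The condition number `κ₂(M) = ‖M‖₂ ‖M†‖₂` of a matrix with linearly independent columns. -/
def cond2 {m n : ℕ} (M : Matrix (Fin m) (Fin n) ℝ) : ℝ := specNorm M * specNorm (pinv M)

/-! ### Error constants -/

/-- `γ_k = k u / (1 - k u)`; it is used only when `k u < 1`. -/
def gam (u : ℝ) (k : ℕ) : ℝ := k * u / (1 - k * u)

/-- `C₁ = √(sn) γ_m + √n γ̃_{sn} (1 + √(sn) γ_m)`, with `γ̃_{sn} = γ_{c s n}`. -/
def C1 (c : ℕ) (u : ℝ) (m s n : ℕ) : ℝ :=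
  √((s : ℝ) * n) * gam u m
    + √(n : ℝ) * gam u (c * s * n) * (1 + √((s : ℝ) * n) * gam u m)

/-- `k(S) = ‖S‖₂ ‖(S Q_A)†‖₂`. -/
def kS {m s n : ℕ} (S : Matrix (Fin s) (Fin m) ℝ) (QA : Matrix (Fin m) (Fin n) ℝ) : ℝ :=
  specNorm S * specNorm (pinv (S * QA))

/-! ### Floating-point arithmetic -/

/-- The standard model of floating-point arithmetic: `y` is a possible computed value of an
elementary operation (`+`, `-`, `*`, `/`, `√`) whose exact result is `x`. -/
def IsFl (u x y : ℝ) : Prop := ∃ δ : ℝ, |δ| ≤ u ∧ y = x * (1 + δ)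

/-- `FlSum u f I r`: `r` is a possible computed value of the nonempty sum `∑ i ∈ I, f i`. Each of
the `|I| - 1` additions is rounded; the order of evaluation is arbitrary. -/
inductive FlSum {ι : Type} [DecidableEq ι] (u : ℝ) (f : ι → ℝ) : Finset ι → ℝ → Prop
  | single (i : ι) : FlSum u f {i} (f i)
  | add (I J : Finset ι) (a b r : ℝ) (hIJ : Disjoint I J)
      (ha : FlSum u f I a) (hb : FlSum u f J b) (hr : IsFl u (a + b) r) : FlSum u f (I ∪ J) r

/-- `r` is a possible computed value of the inner product `∑ i ∈ I, x i * y i`. -/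
def FlDot {ι : Type} [DecidableEq ι] (u : ℝ) (I : Finset ι) (x y : ι → ℝ) (r : ℝ) : Prop :=
  ∃ p : ι → ℝ, (∀ i ∈ I, IsFl u (x i * y i) (p i)) ∧ FlSum u p I r

/-- `r` is a possible computed value of the Euclidean norm `√(∑ i ∈ I, x i ^ 2)`. -/
def FlNorm {ι : Type} [DecidableEq ι] (u : ℝ) (I : Finset ι) (x : ι → ℝ) (r : ℝ) : Prop :=
  ∃ q : ℝ, FlDot u I x x q ∧ IsFl u (√q) r

/-- `P` is a possible computed value of the matrix product `M * N` by the standard algorithm. -/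
def FlMul {s m n : ℕ} (u : ℝ) (M : Matrix (Fin s) (Fin m) ℝ) (N : Matrix (Fin m) (Fin n) ℝ)
    (P : Matrix (Fin s) (Fin n) ℝ) : Prop :=
  ∀ i j, FlDot u Finset.univ (fun l => M i l) (fun l => N l j) (P i j)

/-- `HouseholderStep u p k W W'`: one step of Householder QR in floating point, which eliminates
column `k` of `W` below the pivot row `p` and yields `W'`. With `x` the part of column `k` in the
rows `≥ p`, the step computes
`σ = ‖x‖₂`, `τ = sign(x_p) σ`, `v = x + τ e_p`, `β = 1 / (τ v_p)`,
replaces `x` by `-τ e_p`, and replaces the part `b` of every column `j > k` in the rows `≥ p` by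
`b - (β (vᵀ b)) v`. If `σ = 0`, nothing is done. -/
def HouseholderStep {s n : ℕ} (u : ℝ) (p : Fin s) (k : Fin n)
    (W W' : Matrix (Fin s) (Fin n) ℝ) : Prop :=
  ∃ σ : ℝ, FlNorm u (Finset.Ici p) (fun i => W i k) σ ∧
    ((σ = 0 ∧ W' = W) ∨
      (σ ≠ 0 ∧ ∃ (τ d β : ℝ) (v : Fin s → ℝ),
        τ = (if W p k < 0 then -σ else σ) ∧
        IsFl u (W p k + τ) (v p) ∧
        (∀ i, p < i → v i = W i k) ∧
        IsFl u (τ * v p) d ∧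
        IsFl u (1 / d) β ∧
        (∀ i j, i < p ∨ j < k → W' i j = W i j) ∧
        W' p k = -τ ∧
        (∀ i, p < i → W' i k = 0) ∧
        ∀ j, k < j → ∃ w t : ℝ,
          FlDot u (Finset.Ici p) v (fun i => W i j) w ∧
          IsFl u (β * w) t ∧
          ∀ i, p ≤ i → ∃ q : ℝ, IsFl u (t * v i) q ∧ IsFl u (W i j - q) (W' i j)))

/-- `R` is a possible computed triangular factor of Householder QR applied to `B`. -/
def FlHouseholderR {s n : ℕ} (u : ℝ) (hns : n ≤ s) (B : Matrix (Fin s) (Fin n) ℝ)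
    (R : Matrix (Fin n) (Fin n) ℝ) : Prop :=
  ∃ W : ℕ → Matrix (Fin s) (Fin n) ℝ,
    W 0 = B ∧
    (∀ k : Fin n, HouseholderStep u (Fin.castLE hns k) k (W k) (W (k + 1))) ∧
    ∀ i j, R i j = W n (Fin.castLE hns i) j

/-- `y` is a possible computed solution of `Rᵀ y = a`, `R` upper triangular, by forward
substitution `y_i = (a_i - ∑_{j < i} R_{ji} y_j) / R_{ii}`. -/
def FlForwardSubst {n : ℕ} (u : ℝ) (R : Matrix (Fin n) (Fin n) ℝ) (a y : Fin n → ℝ) : Prop :=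
  ∀ i, ∃ (p : Fin n → ℝ) (t : ℝ),
    (∀ j, j < i → IsFl u (R j i * y j) (p j)) ∧
    FlSum u (fun j => if j = i then a i else -p j) (Finset.Iic i) t ∧
    IsFl u (t / R i i) (y i)

/-- `Y` is a possible computed value of `A R⁻¹`: row `i` of `Y` is obtained from row `i` of `A` by
forward substitution with `Rᵀ`. -/
def FlRightSolve {m n : ℕ} (u : ℝ) (A : Matrix (Fin m) (Fin n) ℝ) (R : Matrix (Fin n) (Fin n) ℝ)
    (Y : Matrix (Fin m) (Fin n) ℝ) : Prop :=
  ∀ i, FlForwardSubst u R (A i) (Y i)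

end

end SketchApply

/-!
Every column of `B̂` undergoes at most `n` rounded reflections, each within `O(su)` of an exact
reflection that is the same for all columns. So `R̂ᵀR̂ = (SA + E)ᵀ(SA + E)` holds exactly for some
perturbation with `‖E‖₂ ≤ C₁ ‖S‖₂ ‖A‖₂`. Put `g = ‖(S Q_A)†‖₂` and `κ = κ₂(S Q_A)`. On the range
of `Q_A`, where the columns of `A` lie, `‖y‖ ≤ g ‖S y‖ ≤ κ ‖y‖`; the bound on `κ₂(A)` says that
`3 g ‖E x‖ ≤ ‖A x‖`. Hence `(2/3) ‖A x‖ ≤ g ‖R̂ x‖ ≤ (κ + 1/3) ‖A x‖`, so the exact `A R̂⁻¹` is well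
conditioned. The residual `A - Ŷ R̂` of the substitutions is small relative to `‖A x‖` in the same
sense, so for `w = R̂ x` the norm of `Ŷ w` is at least `(2/3) ‖A x‖`, while `‖Ŷ‖₂ ≤ 2 g`.
-/

namespace SketchApply

/-! ### Rounding errors -/

section RelApprox

/-- `y` approximates `x` up to `k` roundings: `y = x * ρ`, where `ρ` obeys the bounds
`(1 - u) ^ k ≤ ρ ≤ (1 - u) ^ (-k)` of a product of `k` factors `1 + δ` or `1 / (1 + δ)` with
`|δ| ≤ u`. This is Stewart's relative error counter `⟨k⟩`. -/
def RelApprox (u : ℝ) (k : ℕ) (x y : ℝ) : Prop :=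
  ∃ ρ, (1 - u) ^ k ≤ ρ ∧ ρ * (1 - u) ^ k ≤ 1 ∧ y = x * ρ

variable {u x y z x' y' : ℝ} {k l : ℕ}

theorem gam_nonneg (hu₀ : 0 ≤ u) (hk : k * u < 1) : 0 ≤ gam u k :=
  div_nonneg (by positivity) (by linarith)

namespace RelApprox

theorem refl (hu₀ : 0 ≤ u) (hu : u < 1) (k : ℕ) (x : ℝ) : RelApprox u k x x := by
  have h : (1 - u) ^ k ≤ 1 := pow_le_one₀ (by linarith) (by linarith)
  exact ⟨1, h, by simpa using h, (mul_one x).symm⟩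

theorem mono (hu₀ : 0 ≤ u) (hu : u < 1) (hkl : k ≤ l) (h : RelApprox u k x y) :
    RelApprox u l x y := by
  obtain ⟨ρ, hρ, hρ', rfl⟩ := h
  have hpow : (1 - u) ^ l ≤ (1 - u) ^ k := pow_le_pow_of_le_one (by linarith) (by linarith) hkl
  have hρ₀ : 0 ≤ ρ := (pow_nonneg (by linarith) k).trans hρ
  exact ⟨ρ, hpow.trans hρ, (mul_le_mul_of_nonneg_left hpow hρ₀).trans hρ', rfl⟩

theorem of_isFl (hu : u < 1) (h : IsFl u x y) : RelApprox u 1 x y := by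
  obtain ⟨δ, hδ, rfl⟩ := h
  have := abs_le.1 hδ
  refine ⟨1 + δ, ?_, ?_, rfl⟩
  · rw [pow_one]
    linarith
  · nlinarith [mul_self_nonneg u]

theorem mul (hu : u < 1) (h : RelApprox u k x y) (h' : RelApprox u l x' y') :
    RelApprox u (k + l) (x * x') (y * y') := by
  obtain ⟨ρ, hρ, hρ₁, rfl⟩ := h
  obtain ⟨μ, hμ, hμ₁, rfl⟩ := h'
  have hk : 0 ≤ (1 - u) ^ k := pow_nonneg (by linarith) k
  have hl : 0 ≤ (1 - u) ^ l := pow_nonneg (by linarith) l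
  refine ⟨ρ * μ, ?_, ?_, by ring⟩
  · rw [pow_add]
    exact mul_le_mul hρ hμ hl (hk.trans hρ)
  · calc ρ * μ * (1 - u) ^ (k + l) = ρ * (1 - u) ^ k * (μ * (1 - u) ^ l) := by ring
      _ ≤ 1 := mul_le_one₀ hρ₁ (mul_nonneg (hl.trans hμ) hl) hμ₁

theorem trans (hu : u < 1) (h : RelApprox u k x y) (h' : RelApprox u l y z) :
    RelApprox u (k + l) x z := by
  obtain ⟨μ, hμ, hμ₁, rfl⟩ := h'
  simpa using h.mul hu (x' := 1) (y' := μ) ⟨μ, hμ, hμ₁, (one_mul μ).symm⟩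

theorem inv (hu : u < 1) (h : RelApprox u k x y) : RelApprox u k x⁻¹ y⁻¹ := by
  obtain ⟨ρ, hρ, hρ₁, rfl⟩ := h
  have hk : 0 < (1 - u) ^ k := pow_pos (by linarith) k
  have hρ₀ : 0 < ρ := hk.trans_le hρ
  refine ⟨ρ⁻¹, ?_, ?_, mul_inv x ρ⟩
  · rwa [le_inv_comm₀ hk hρ₀, ← one_div, le_div_iff₀ hk]
  · rwa [inv_mul_le_iff₀ hρ₀, mul_one]

theorem symm (hu : u < 1) (h : RelApprox u k x y) : RelApprox u k y x := by
  obtain ⟨ρ, hρ, hρ₁, rfl⟩ := h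
  have hρ₀ : 0 < ρ := (pow_pos (by linarith) k).trans_le hρ
  obtain ⟨μ, hμ, hμ₁, h⟩ := inv hu ⟨ρ, hρ, hρ₁, (one_mul ρ).symm⟩
  refine ⟨μ, hμ, hμ₁, ?_⟩
  rw [inv_one, one_mul] at h
  rw [← h, mul_inv_cancel_right₀ hρ₀.ne']

theorem neg (h : RelApprox u k x y) : RelApprox u k (-x) (-y) := by
  obtain ⟨ρ, hρ, hρ₁, rfl⟩ := h
  exact ⟨ρ, hρ, hρ₁, (neg_mul x ρ).symm⟩

theorem eq_zero_iff (hu : u < 1) (h : RelApprox u k x y) : y = 0 ↔ x = 0 := by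
  obtain ⟨ρ, hρ, -, rfl⟩ := h
  exact mul_eq_zero_iff_right ((pow_pos (by linarith) k).trans_le hρ).ne'

theorem sqrt (hu₀ : 0 ≤ u) (hu : u < 1) (h : RelApprox u k x y) : RelApprox u k √x √y := by
  obtain ⟨ρ, hρ, hρ₁, rfl⟩ := h
  have hk₀ : 0 ≤ (1 - u) ^ k := pow_nonneg (by linarith) k
  have hk₁ : (1 - u) ^ k ≤ 1 := pow_le_one₀ (by linarith) (by linarith)
  have hρ₀ : 0 ≤ ρ := hk₀.trans hρ
  refine ⟨√ρ, Real.le_sqrt_of_sq_le (by nlinarith), ?_, Real.sqrt_mul' x hρ₀⟩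
  refine abs_le_one_iff_mul_self_le_one.2 ?_ |> (le_abs_self _).trans
  calc √ρ * (1 - u) ^ k * (√ρ * (1 - u) ^ k) = ρ * (1 - u) ^ k * (1 - u) ^ k := by
        rw [mul_mul_mul_comm, Real.mul_self_sqrt hρ₀, mul_assoc]
    _ ≤ 1 := mul_le_one₀ hρ₁ hk₀ hk₁

end RelApprox

theorem relApprox_iff_of_nonneg (hu₀ : 0 ≤ u) (hu : u < 1) (hx : 0 ≤ x) :
    RelApprox u k x y ↔ x * (1 - u) ^ k ≤ y ∧ y * (1 - u) ^ k ≤ x := by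
  have hk : 0 < (1 - u) ^ k := pow_pos (by linarith) k
  constructor
  · rintro ⟨ρ, hρ, hρ₁, rfl⟩
    refine ⟨mul_le_mul_of_nonneg_left hρ hx, ?_⟩
    rw [mul_assoc]
    exact mul_le_of_le_one_right hx hρ₁
  · rintro ⟨hxy, hyx⟩
    rcases hx.eq_or_lt with rfl | hx
    · obtain rfl : y = 0 := le_antisymm (nonpos_of_mul_nonpos_left hyx hk) (by simpa using hxy)
      exact .refl hu₀ hu k 0
    · refine ⟨y / x, ?_, ?_, (mul_div_cancel₀ y hx.ne').symm⟩
      · rwa [le_div_iff₀' hx]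
      · rwa [div_mul_eq_mul_div, div_le_one hx]

namespace RelApprox

theorem sum_of_nonneg {ι : Type*} {I : Finset ι} {f g : ι → ℝ} (hu₀ : 0 ≤ u) (hu : u < 1)
    (hf : ∀ i ∈ I, 0 ≤ f i) (h : ∀ i ∈ I, RelApprox u k (f i) (g i)) :
    RelApprox u k (∑ i ∈ I, f i) (∑ i ∈ I, g i) := by
  rw [relApprox_iff_of_nonneg hu₀ hu (Finset.sum_nonneg hf), Finset.sum_mul, Finset.sum_mul]
  have h' i (hi : i ∈ I) := (relApprox_iff_of_nonneg hu₀ hu (hf i hi)).1 (h i hi)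
  exact ⟨Finset.sum_le_sum fun i hi => (h' i hi).1, Finset.sum_le_sum fun i hi => (h' i hi).2⟩

theorem add_of_nonneg (hu₀ : 0 ≤ u) (hu : u < 1) (hx : 0 ≤ x) (hx' : 0 ≤ x')
    (h : RelApprox u k x y) (h' : RelApprox u k x' y') : RelApprox u k (x + x') (y + y') := by
  simpa using sum_of_nonneg hu₀ hu (I := Finset.univ) (f := ![x, x']) (g := ![y, y'])
    (by simp [hx, hx']) (by simp [h, h'])

theorem add_of_mul_nonneg (hu₀ : 0 ≤ u) (hu : u < 1) (hxx' : 0 ≤ x * x')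
    (h : RelApprox u k x y) (h' : RelApprox u k x' y') : RelApprox u k (x + x') (y + y') := by
  rcases mul_nonneg_iff.1 hxx' with ⟨hx, hx'⟩ | ⟨hx, hx'⟩
  · exact add_of_nonneg hu₀ hu hx hx' h h'
  · simpa [add_comm] using
      (add_of_nonneg hu₀ hu (neg_nonneg.2 hx) (neg_nonneg.2 hx') h.neg h'.neg).neg

theorem exists_factor (h : RelApprox u k x y) : ∃ ρ, RelApprox u k 1 ρ ∧ y = x * ρ := by
  obtain ⟨ρ, hρ, hρ₁, rfl⟩ := h
  exact ⟨ρ, ⟨ρ, hρ, hρ₁, (one_mul ρ).symm⟩, rfl⟩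

theorem mul_factor {ρ : ℝ} (hu : u < 1) (h : RelApprox u k x y) (hρ : RelApprox u l 1 ρ) :
    RelApprox u (k + l) x (y * ρ) := by
  simpa using h.mul hu hρ

theorem abs_sub_le (hu : u < 1) (hk : k * u < 1) (h : RelApprox u k x y) :
    |y - x| ≤ gam u k * |x| := by
  obtain ⟨ρ, hρ, hρ₁, rfl⟩ := h
  have hbern : 1 - k * u ≤ (1 - u) ^ k := by
    simpa [sub_eq_add_neg] using one_add_mul_le_pow (a := -u) (by linarith) k
  have hpos : 0 < 1 - k * u := by linarith
  have hlower : 1 - ρ ≤ gam u k := by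
    rw [gam, le_div_iff₀ hpos]
    nlinarith [sq_nonneg (1 - ρ), pow_pos (show 0 < 1 - u by linarith) k]
  have hupper : ρ - 1 ≤ gam u k := by
    rw [gam, le_div_iff₀ hpos]
    nlinarith
  rw [show x * ρ - x = (ρ - 1) * x by ring, abs_mul]
  exact mul_le_mul_of_nonneg_right (abs_sub_le_iff.2 ⟨hupper, hlower⟩) (abs_nonneg x)

theorem abs_sum_sub_sum_le {ι : Type*} {I : Finset ι} {f g : ι → ℝ} (hu : u < 1) (hk : k * u < 1)
    (h : ∀ i ∈ I, RelApprox u k (f i) (g i)) :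
    |∑ i ∈ I, g i - ∑ i ∈ I, f i| ≤ gam u k * ∑ i ∈ I, |f i| := by
  rw [← Finset.sum_sub_distrib, Finset.mul_sum]
  exact (Finset.abs_sum_le_sum_abs _ _).trans
    (Finset.sum_le_sum fun i hi => (h i hi).abs_sub_le hu hk)

end RelApprox

variable {ι : Type} [DecidableEq ι] {I : Finset ι} {f a b : ι → ℝ} {r : ℝ}

theorem FlSum.nonempty (h : FlSum u f I r) : I.Nonempty := by
  induction h with
  | single i => exact Finset.singleton_nonempty i
  | add _ _ _ _ _ _ _ _ _ ih => exact ih.mono Finset.subset_union_left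

theorem FlSum.exists_relApprox (hu₀ : 0 ≤ u) (hu : u < 1) (h : FlSum u f I r) :
    ∃ g : ι → ℝ, (∀ i, RelApprox u (I.card - 1) (f i) (g i)) ∧ r = ∑ i ∈ I, g i := by
  induction h with
  | single i => exact ⟨f, fun j => .refl hu₀ hu _ _, (Finset.sum_singleton f i).symm⟩
  | add I J a b r hIJ ha hb hr iha ihb =>
    obtain ⟨g, hg, rfl⟩ := iha
    obtain ⟨g', hg', rfl⟩ := ihb
    obtain ⟨ρ, hρ, rfl⟩ := (RelApprox.of_isFl hu hr).exists_factor
    have hcard := Finset.card_union_of_disjoint hIJ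
    have hI := ha.nonempty.card_pos
    have hJ := hb.nonempty.card_pos
    refine ⟨fun i => (if i ∈ I then g i else g' i) * ρ, fun i => ?_, ?_⟩
    · dsimp only
      split_ifs
      · exact ((hg i).mul_factor hu hρ).mono hu₀ hu (by omega)
      · exact ((hg' i).mul_factor hu hρ).mono hu₀ hu (by omega)
    · rw [Finset.sum_union hIJ, add_mul, Finset.sum_mul, Finset.sum_mul]
      congr 1
      · exact Finset.sum_congr rfl fun i hi => by rw [if_pos hi]
      · exact Finset.sum_congr rfl fun i hi => by rw [if_neg (Finset.disjoint_right.1 hIJ hi)]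

theorem FlDot.exists_relApprox (hu₀ : 0 ≤ u) (hu : u < 1) (h : FlDot u I a b r) :
    ∃ g : ι → ℝ, (∀ i ∈ I, RelApprox u I.card (a i * b i) (g i)) ∧ r = ∑ i ∈ I, g i := by
  obtain ⟨p, hp, hsum⟩ := h
  have hcard : 1 + (I.card - 1) = I.card := Nat.add_sub_cancel' hsum.nonempty.card_pos
  obtain ⟨g, hg, rfl⟩ := hsum.exists_relApprox hu₀ hu
  exact ⟨g, fun i hi => hcard ▸ (RelApprox.of_isFl hu (hp i hi)).trans hu (hg i), rfl⟩

theorem FlDot.abs_sub_le (hu₀ : 0 ≤ u) (hu : u < 1) (hI : I.card * u < 1) (h : FlDot u I a b r) :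
    |r - ∑ i ∈ I, a i * b i| ≤ gam u I.card * ∑ i ∈ I, |a i| * |b i| := by
  obtain ⟨g, hg, rfl⟩ := h.exists_relApprox hu₀ hu
  simpa only [abs_mul] using RelApprox.abs_sum_sub_sum_le hu hI hg

theorem FlNorm.relApprox (hu₀ : 0 ≤ u) (hu : u < 1) (h : FlNorm u I a r) :
    RelApprox u (I.card + 1) √(∑ i ∈ I, a i ^ 2) r := by
  obtain ⟨q, hdot, hr⟩ := h
  obtain ⟨g, hg, rfl⟩ := hdot.exists_relApprox hu₀ hu
  simp only [pow_two]
  exact ((RelApprox.sum_of_nonneg hu₀ hu (fun i _ => mul_self_nonneg (a i)) hg).sqrt hu₀ hu).trans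
    hu (.of_isFl hu hr)

end RelApprox

section gam

variable {u : ℝ} {j k : ℕ}

theorem gam_mono (hu₀ : 0 ≤ u) (hjk : j ≤ k) (hk : k * u < 1) : gam u j ≤ gam u k := by
  have hjk' : (j : ℝ) * u ≤ k * u := by gcongr
  rw [gam, gam, div_le_div_iff₀ (by linarith) (by linarith)]
  linarith

theorem mul_gam_le (hu₀ : 0 ≤ u) (hk : (j * k : ℕ) * u < 1) : j * gam u k ≤ gam u (j * k) := by
  rcases j.eq_zero_or_pos with rfl | hj
  · simp [gam]
  have hle : (k : ℝ) * u ≤ (j * k : ℕ) * u := by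
    gcongr
    exact Nat.le_mul_of_pos_left k hj
  rw [gam, gam, ← mul_div_assoc, ← mul_assoc, ← Nat.cast_mul]
  have : 0 ≤ ((j * k : ℕ) : ℝ) * u := by positivity
  gcongr

theorem one_add_gam (hk : k * u < 1) : 1 + gam u k = (1 - k * u)⁻¹ := by
  have : 1 - k * u ≠ 0 := by linarith
  rw [gam]
  field_simp
  ring

theorem one_add_gam_pow_le (hu₀ : 0 ≤ u) (hk : (j * k : ℕ) * u < 1) :
    (1 + gam u k) ^ j ≤ 1 + gam u (j * k) := by
  rcases j.eq_zero_or_pos with rfl | hj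
  · simp [gam]
  have hle : (k : ℝ) * u ≤ (j * k : ℕ) * u := by
    gcongr
    exact Nat.le_mul_of_pos_left k hj
  have hbern : 1 - (j * k : ℕ) * u ≤ (1 - k * u) ^ j := by
    have := one_add_mul_le_pow (a := -(k * u)) (by linarith) j
    rw [← sub_eq_add_neg] at this
    push_cast
    linarith
  rw [one_add_gam (by linarith), one_add_gam hk, inv_pow]
  exact inv_anti₀ (by linarith) hbern

theorem gam_le_of_gam_le_third (hu₀ : 0 ≤ u) (hk : k * u < 1) (h : gam u k ≤ 1 / 3) :
    gam u k ≤ 4 / 3 * (k * u) := by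
  have hpos : 0 < 1 - k * u := by linarith
  have hsmall : k * u ≤ 1 / 4 := by
    rw [gam, div_le_iff₀ hpos] at h
    linarith
  rw [gam, div_le_iff₀ hpos]
  nlinarith [mul_nonneg k.cast_nonneg hu₀]

end gam

/-! ### Euclidean norm, spectral norm, pseudo-inverse -/

section l2Norm

variable {ι κ ι' : Type*} [Fintype ι] [Fintype κ] [Fintype ι']

/-- The Euclidean norm of a coordinate vector, that is of a function `ι → ℝ`; the norm instance
of this function type is the supremum norm. -/
noncomputable def l2Norm (x : ι → ℝ) : ℝ := ‖WithLp.toLp 2 x‖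

theorem l2Norm_nonneg (x : ι → ℝ) : 0 ≤ l2Norm x := norm_nonneg _

theorem l2Norm_sq (x : ι → ℝ) : l2Norm x ^ 2 = ∑ i, x i ^ 2 := by
  simp [l2Norm, EuclideanSpace.norm_sq_eq]

theorem l2Norm_sq_eq_dotProduct (x : ι → ℝ) : l2Norm x ^ 2 = x ⬝ᵥ x := by
  rw [l2Norm_sq]
  exact Finset.sum_congr rfl fun i _ => pow_two (x i)

@[simp] theorem l2Norm_zero : l2Norm (0 : ι → ℝ) = 0 := by simp [l2Norm]

@[simp] theorem l2Norm_eq_zero {x : ι → ℝ} : l2Norm x = 0 ↔ x = 0 := by simp [l2Norm]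

@[simp] theorem l2Norm_single_one [DecidableEq ι] (i : ι) :
    l2Norm (Pi.single i 1 : ι → ℝ) = 1 := by
  simp [l2Norm]

theorem l2Norm_add_le (x y : ι → ℝ) : l2Norm (x + y) ≤ l2Norm x + l2Norm y := by
  simpa [l2Norm] using norm_add_le (WithLp.toLp 2 x) (WithLp.toLp 2 y)

theorem l2Norm_smul (c : ℝ) (x : ι → ℝ) : l2Norm (c • x) = |c| * l2Norm x := by
  simp [l2Norm, norm_smul]

theorem l2Norm_sub_comm (x y : ι → ℝ) : l2Norm (x - y) = l2Norm (y - x) := by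
  simpa [l2Norm] using norm_sub_rev (WithLp.toLp 2 x) (WithLp.toLp 2 y)

theorem l2Norm_le_add_sub (x y : ι → ℝ) : l2Norm x ≤ l2Norm y + l2Norm (x - y) := by
  simpa using l2Norm_add_le y (x - y)

theorem l2Norm_mono {x y : ι → ℝ} (h : ∀ i, |x i| ≤ |y i|) : l2Norm x ≤ l2Norm y := by
  refine le_of_sq_le_sq ?_ (l2Norm_nonneg y)
  rw [l2Norm_sq, l2Norm_sq]
  exact Finset.sum_le_sum fun i _ => sq_le_sq.2 (h i)

@[simp] theorem l2Norm_abs (x : ι → ℝ) : l2Norm (fun i => |x i|) = l2Norm x :=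
  le_antisymm (l2Norm_mono fun _ => (abs_abs _).le) (l2Norm_mono fun _ => (abs_abs _).ge)

theorem abs_dotProduct_le (x y : ι → ℝ) : |x ⬝ᵥ y| ≤ l2Norm x * l2Norm y := by
  simpa [l2Norm, EuclideanSpace.inner_eq_star_dotProduct, dotProduct_comm] using
    abs_real_inner_le_norm (WithLp.toLp 2 x) (WithLp.toLp 2 y)

theorem sum_abs_mul_abs_le (x y : ι → ℝ) : ∑ i, |x i| * |y i| ≤ l2Norm x * l2Norm y := by
  have h := (le_abs_self _).trans (abs_dotProduct_le (fun i => |x i|) fun i => |y i|)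
  rwa [l2Norm_abs, l2Norm_abs] at h

theorem l2Norm_mulVec_eq_of_transpose_mul_eq {M : Matrix ι κ ℝ} {N : Matrix ι' κ ℝ}
    (h : Mᵀ * M = Nᵀ * N) (x : κ → ℝ) : l2Norm (M *ᵥ x) = l2Norm (N *ᵥ x) := by
  refine (pow_left_inj₀ (l2Norm_nonneg _) (l2Norm_nonneg _) two_ne_zero).1 ?_
  rw [l2Norm_sq_eq_dotProduct, l2Norm_sq_eq_dotProduct, dotProduct_mulVec, dotProduct_mulVec,
    vecMul_mulVec, vecMul_mulVec, h]

theorem l2Norm_mulVec_of_transpose_mul_self [DecidableEq κ] {Q : Matrix ι κ ℝ} (h : Qᵀ * Q = 1)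
    (x : κ → ℝ) : l2Norm (Q *ᵥ x) = l2Norm x := by
  simpa using l2Norm_mulVec_eq_of_transpose_mul_eq (N := (1 : Matrix κ κ ℝ)) (by simpa using h) x

theorem linearIndependent_col_of_l2Norm_le {M : Matrix ι κ ℝ} {C : ℝ}
    (h : ∀ x, l2Norm x ≤ C * l2Norm (M *ᵥ x)) : LinearIndependent ℝ M.col := by
  rw [← mulVec_injective_iff]
  intro x y hxy
  have hle := h (x - y)
  rw [mulVec_sub, sub_eq_zero.2 hxy, l2Norm_zero, mul_zero] at hle
  exact sub_eq_zero.1 (l2Norm_eq_zero.1 (hle.antisymm (l2Norm_nonneg _)))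

end l2Norm

section specNorm

variable {l m n : ℕ}

theorem specNorm_nonneg (M : Matrix (Fin m) (Fin n) ℝ) : 0 ≤ specNorm M := by
  open scoped Matrix.Norms.L2Operator in exact norm_nonneg M

theorem l2Norm_mulVec_le (M : Matrix (Fin m) (Fin n) ℝ) (x : Fin n → ℝ) :
    l2Norm (M *ᵥ x) ≤ specNorm M * l2Norm x :=
  M.l2_opNorm_mulVec (WithLp.toLp 2 x)

theorem specNorm_le {M : Matrix (Fin m) (Fin n) ℝ} {C : ℝ} (hC : 0 ≤ C)
    (h : ∀ x, l2Norm (M *ᵥ x) ≤ C * l2Norm x) : specNorm M ≤ C := by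
  rw [specNorm, l2_opNorm_def]
  exact ContinuousLinearMap.opNorm_le_bound _ hC fun x => h x.ofLp

theorem l2Norm_col_le (M : Matrix (Fin m) (Fin n) ℝ) (j : Fin n) :
    l2Norm (M.col j) ≤ specNorm M := by
  simpa using l2Norm_mulVec_le M (Pi.single j 1)

theorem specNorm_transpose (M : Matrix (Fin m) (Fin n) ℝ) : specNorm Mᵀ = specNorm M := by
  rw [← conjTranspose_eq_transpose_of_trivial]
  exact M.l2_opNorm_conjTranspose

theorem specNorm_mul_le (M : Matrix (Fin l) (Fin m) ℝ) (N : Matrix (Fin m) (Fin n) ℝ) :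
    specNorm (M * N) ≤ specNorm M * specNorm N :=
  M.l2_opNorm_mul N

theorem specNorm_add_le (M N : Matrix (Fin m) (Fin n) ℝ) :
    specNorm (M + N) ≤ specNorm M + specNorm N := by
  open scoped Matrix.Norms.L2Operator in exact norm_add_le M N

theorem isUnit_transpose_mul_self {M : Matrix (Fin m) (Fin n) ℝ}
    (h : LinearIndependent ℝ M.col) : IsUnit (Mᵀ * M) := by
  rw [← mulVec_injective_iff_isUnit, ← coe_mulVecLin, ← LinearMap.ker_eq_bot,
    ← conjTranspose_eq_transpose_of_trivial, ker_mulVecLin_conjTranspose_mul_self,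
    LinearMap.ker_eq_bot, coe_mulVecLin]
  exact mulVec_injective_iff.2 h

theorem pinv_mul_self {M : Matrix (Fin m) (Fin n) ℝ} (h : LinearIndependent ℝ M.col) :
    pinv M * M = 1 := by
  rw [pinv, Matrix.mul_assoc]
  exact nonsing_inv_mul _ ((isUnit_iff_isUnit_det _).1 (isUnit_transpose_mul_self h))

theorem transpose_mul_self_mul_pinv {M : Matrix (Fin m) (Fin n) ℝ}
    (h : LinearIndependent ℝ M.col) : Mᵀ * M * pinv M = Mᵀ := by
  rw [pinv, mul_nonsing_inv_cancel_left _ _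
    ((isUnit_iff_isUnit_det _).1 (isUnit_transpose_mul_self h))]

theorem l2Norm_le_specNorm_pinv_mul {M : Matrix (Fin m) (Fin n) ℝ}
    (h : LinearIndependent ℝ M.col) (x : Fin n → ℝ) :
    l2Norm x ≤ specNorm (pinv M) * l2Norm (M *ᵥ x) := by
  simpa [mulVec_mulVec, pinv_mul_self h] using l2Norm_mulVec_le (pinv M) (M *ᵥ x)

theorem l2Norm_mulVec_pinv_mulVec_le {M : Matrix (Fin m) (Fin n) ℝ}
    (h : LinearIndependent ℝ M.col) (y : Fin m → ℝ) :
    l2Norm (M *ᵥ (pinv M *ᵥ y)) ≤ l2Norm y := by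
  set z := pinv M *ᵥ y with hz
  have hnormal : Mᵀ *ᵥ (M *ᵥ z) = Mᵀ *ᵥ y := by
    rw [hz, mulVec_mulVec, mulVec_mulVec, transpose_mul_self_mul_pinv h]
  have hsq : l2Norm (M *ᵥ z) * l2Norm (M *ᵥ z) ≤ l2Norm (M *ᵥ z) * l2Norm y := by
    calc l2Norm (M *ᵥ z) * l2Norm (M *ᵥ z) = (M *ᵥ z) ⬝ᵥ y := by
          rw [← pow_two, l2Norm_sq_eq_dotProduct, dotProduct_comm _ y, dotProduct_mulVec (M *ᵥ z),
            dotProduct_mulVec y, ← mulVec_transpose, ← mulVec_transpose, hnormal]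
      _ ≤ l2Norm (M *ᵥ z) * l2Norm y := (le_abs_self _).trans (abs_dotProduct_le _ _)
  rcases (l2Norm_nonneg (M *ᵥ z)).eq_or_lt with hzero | hpos
  · rw [← hzero]
    exact l2Norm_nonneg y
  · exact le_of_mul_le_mul_left hsq hpos

theorem specNorm_pinv_le {M : Matrix (Fin m) (Fin n) ℝ} {C : ℝ} (hC : 0 ≤ C)
    (h : ∀ x, l2Norm x ≤ C * l2Norm (M *ᵥ x)) : specNorm (pinv M) ≤ C :=
  specNorm_le hC fun y => (h _).trans <| mul_le_mul_of_nonneg_left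
    (l2Norm_mulVec_pinv_mulVec_le (linearIndependent_col_of_l2Norm_le h) y) hC

theorem one_le_cond2 {M : Matrix (Fin m) (Fin n) ℝ} (hn : 0 < n)
    (h : LinearIndependent ℝ M.col) : 1 ≤ cond2 M := by
  have hcol := l2Norm_le_specNorm_pinv_mul h (Pi.single ⟨0, hn⟩ 1)
  rw [l2Norm_single_one, mulVec_single_one] at hcol
  rw [cond2, mul_comm]
  exact hcol.trans (mul_le_mul_of_nonneg_left (l2Norm_col_le M _) (specNorm_nonneg _))

theorem specNorm_pinv_pos {M : Matrix (Fin m) (Fin n) ℝ} (hn : 0 < n)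
    (h : LinearIndependent ℝ M.col) : 0 < specNorm (pinv M) :=
  pos_of_mul_pos_right (zero_lt_one.trans_le (one_le_cond2 hn h)) (specNorm_nonneg M)

theorem cond2_nonneg (M : Matrix (Fin m) (Fin n) ℝ) : 0 ≤ cond2 M :=
  mul_nonneg (specNorm_nonneg _) (specNorm_nonneg _)

end specNorm

section frobNorm

variable {l m n : ℕ}

open scoped Matrix.Norms.Frobenius in
/-- The Frobenius norm of a matrix, through which entrywise and columnwise error bounds become
bounds on the spectral norm. -/
noncomputable def frobNorm (M : Matrix (Fin m) (Fin n) ℝ) : ℝ := ‖M‖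

theorem frobNorm_nonneg (M : Matrix (Fin m) (Fin n) ℝ) : 0 ≤ frobNorm M := by
  open scoped Matrix.Norms.Frobenius in exact norm_nonneg M

theorem frobNorm_transpose (M : Matrix (Fin m) (Fin n) ℝ) : frobNorm Mᵀ = frobNorm M :=
  frobenius_norm_transpose M

theorem frobNorm_sq (M : Matrix (Fin m) (Fin n) ℝ) : frobNorm M ^ 2 = ∑ i, ∑ j, M i j ^ 2 := by
  rw [frobNorm, frobenius_norm_def, ← Real.sqrt_eq_rpow, Real.sq_sqrt (by positivity)]
  simp

theorem frobNorm_sq_eq_sum_row (M : Matrix (Fin m) (Fin n) ℝ) :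
    frobNorm M ^ 2 = ∑ i, l2Norm (M i) ^ 2 := by
  simp only [frobNorm_sq, l2Norm_sq]

theorem frobNorm_sq_eq_sum_col (M : Matrix (Fin m) (Fin n) ℝ) :
    frobNorm M ^ 2 = ∑ j, l2Norm (M.col j) ^ 2 := by
  rw [← frobNorm_transpose]
  exact frobNorm_sq_eq_sum_row Mᵀ

theorem specNorm_le_frobNorm (M : Matrix (Fin m) (Fin n) ℝ) : specNorm M ≤ frobNorm M := by
  refine specNorm_le (frobNorm_nonneg M) fun x => ?_
  refine le_of_sq_le_sq ?_ (mul_nonneg (frobNorm_nonneg M) (l2Norm_nonneg x))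
  rw [mul_pow, frobNorm_sq_eq_sum_row, Finset.sum_mul, l2Norm_sq]
  refine Finset.sum_le_sum fun i _ => ?_
  rw [← mul_pow, ← sq_abs]
  exact pow_le_pow_left₀ (abs_nonneg _) (abs_dotProduct_le (M i) x) 2

theorem frobNorm_le_sqrt_mul_specNorm (M : Matrix (Fin m) (Fin n) ℝ) :
    frobNorm M ≤ √n * specNorm M := by
  refine le_of_sq_le_sq ?_ (mul_nonneg (Real.sqrt_nonneg _) (specNorm_nonneg M))
  rw [frobNorm_sq_eq_sum_col, mul_pow, Real.sq_sqrt n.cast_nonneg]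
  calc ∑ j, l2Norm (M.col j) ^ 2 ≤ ∑ _j : Fin n, specNorm M ^ 2 :=
        Finset.sum_le_sum fun j _ => pow_le_pow_left₀ (l2Norm_nonneg _) (l2Norm_col_le M j) 2
    _ = n * specNorm M ^ 2 := by simp

theorem frobNorm_le_sqrt_mul_specNorm' (M : Matrix (Fin m) (Fin n) ℝ) :
    frobNorm M ≤ √m * specNorm M := by
  rw [← frobNorm_transpose, ← specNorm_transpose]
  exact frobNorm_le_sqrt_mul_specNorm Mᵀ

theorem frobNorm_le_of_abs_le_mul_sum {E : Matrix (Fin l) (Fin n) ℝ}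
    {M : Matrix (Fin l) (Fin m) ℝ} {N : Matrix (Fin m) (Fin n) ℝ} {ε : ℝ} (hε : 0 ≤ ε)
    (h : ∀ i j, |E i j| ≤ ε * ∑ k, |M i k| * |N k j|) :
    frobNorm E ≤ ε * (frobNorm M * frobNorm N) := by
  refine le_of_sq_le_sq ?_
    (mul_nonneg hε (mul_nonneg (frobNorm_nonneg M) (frobNorm_nonneg N)))
  rw [frobNorm_sq, mul_pow, mul_pow, frobNorm_sq_eq_sum_row M, frobNorm_sq_eq_sum_col N,
    Finset.sum_mul_sum, Finset.mul_sum]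
  refine Finset.sum_le_sum fun i _ => ?_
  rw [Finset.mul_sum]
  refine Finset.sum_le_sum fun j _ => ?_
  rw [← mul_pow, ← mul_pow, ← sq_abs]
  exact pow_le_pow_left₀ (abs_nonneg _)
    ((h i j).trans (mul_le_mul_of_nonneg_left (sum_abs_mul_abs_le (M i) (N.col j)) hε)) 2

theorem frobNorm_le_of_col_le {E M : Matrix (Fin m) (Fin n) ℝ} {ε : ℝ} (hε : 0 ≤ ε)
    (h : ∀ j, l2Norm (E.col j) ≤ ε * l2Norm (M.col j)) : frobNorm E ≤ ε * frobNorm M := by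
  refine le_of_sq_le_sq ?_ (mul_nonneg hε (frobNorm_nonneg M))
  rw [mul_pow, frobNorm_sq_eq_sum_col, frobNorm_sq_eq_sum_col, Finset.mul_sum]
  refine Finset.sum_le_sum fun j _ => ?_
  rw [← mul_pow]
  exact pow_le_pow_left₀ (l2Norm_nonneg _) (h j) 2

end frobNorm

/-! ### Householder QR -/

section reflector

variable {s : ℕ} {β : ℝ} {v : Fin s → ℝ}

/-- The matrix `I - β v vᵀ`. It is the reflection in the hyperplane orthogonal to `v` when
`β (vᵀ v) = 2`. -/
def reflector (β : ℝ) (v : Fin s → ℝ) : Matrix (Fin s) (Fin s) ℝ := 1 - β • vecMulVec v v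

theorem reflector_mulVec (β : ℝ) (v b : Fin s → ℝ) :
    reflector β v *ᵥ b = b - (β * (v ⬝ᵥ b)) • v := by
  simp [reflector, sub_mulVec, smul_mulVec, vecMulVec_mulVec, smul_smul]

theorem reflector_mem_orthogonalGroup (h : β * (v ⬝ᵥ v) = 2) :
    reflector β v ∈ orthogonalGroup (Fin s) ℝ := by
  have hsymm : (reflector β v)ᵀ = reflector β v := by simp [reflector]
  have hrank_one : vecMulVec v v * vecMulVec v v = (v ⬝ᵥ v) • vecMulVec v v := by
    rw [vecMulVec_mul_vecMulVec, vecMulVec_smul]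
  rw [mem_orthogonalGroup_iff']
  change (reflector β v)ᵀ * reflector β v = 1
  rw [hsymm, reflector, sub_mul, mul_sub, mul_sub, smul_mul_smul_comm, hrank_one, smul_smul,
    mul_assoc β β, h, one_mul, one_mul, mul_one]
  module

theorem l2Norm_le_of_abs_le_reflector (hβ : 0 ≤ β) (h : β * (v ⬝ᵥ v) = 2) {ε : ℝ} (hε : 0 ≤ ε)
    {e b : Fin s → ℝ} (he : ∀ i, |e i| ≤ ε * (|b i| + β * |v i| * ∑ l, |v l| * |b l|)) :
    l2Norm e ≤ 3 * ε * l2Norm b := by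
  set T := ∑ l, |v l| * |b l|
  have hT₀ : 0 ≤ T := Finset.sum_nonneg fun l _ => mul_nonneg (abs_nonneg _) (abs_nonneg _)
  have hrank_one : β * T * l2Norm v ≤ 2 * l2Norm b :=
    calc β * T * l2Norm v ≤ β * (l2Norm v * l2Norm b) * l2Norm v := by
          have := sum_abs_mul_abs_le v b
          have := l2Norm_nonneg v
          gcongr
      _ = β * l2Norm v ^ 2 * l2Norm b := by ring
      _ = 2 * l2Norm b := by rw [l2Norm_sq_eq_dotProduct, h]
  have hmono : l2Norm e ≤ l2Norm (ε • ((fun i => |b i|) + (β * T) • fun i => |v i|)) :=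
    l2Norm_mono fun i => ((he i).trans_eq (by
      simp only [Pi.smul_apply, Pi.add_apply, smul_eq_mul]; ring)).trans (le_abs_self _)
  calc l2Norm e ≤ ε * l2Norm ((fun i => |b i|) + (β * T) • fun i => |v i|) := by
        rwa [l2Norm_smul, abs_of_nonneg hε] at hmono
    _ ≤ ε * (l2Norm b + β * T * l2Norm v) := by
        gcongr
        refine (l2Norm_add_le _ _).trans_eq ?_
        rw [l2Norm_smul, l2Norm_abs, l2Norm_abs, abs_of_nonneg (mul_nonneg hβ hT₀)]
    _ ≤ 3 * ε * l2Norm b := by nlinarith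

end reflector

section householderVec

variable {s : ℕ} (p : Fin s) (x : Fin s → ℝ)

/-- The exact quantity `τ = sign(x_p) ‖x‖₂` of the Householder reflector that maps the part of `x`
in the rows `≥ p` to `-τ e_p`, with `sign(0) = 1`. -/
noncomputable def householderTau : ℝ :=
  if x p < 0 then -√(∑ i ∈ Finset.Ici p, x i ^ 2) else √(∑ i ∈ Finset.Ici p, x i ^ 2)

/-- The exact Householder vector `v = x + τ e_p`, where `x` is cut off above the row `p`. -/
noncomputable def householderVec : Fin s → ℝ :=
  (Set.Ici p).indicator x + Pi.single p (householderTau p x)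

/-- The exact Householder coefficient `β = 1 / (τ v_p)`; it is meaningful only when `τ ≠ 0`. -/
noncomputable def householderCoeff : ℝ := 1 / (householderTau p x * householderVec p x p)

theorem sq_householderTau : householderTau p x ^ 2 = ∑ i ∈ Finset.Ici p, x i ^ 2 := by
  have hsq := Real.sq_sqrt (Finset.sum_nonneg fun i (_ : i ∈ Finset.Ici p) => sq_nonneg (x i))
  rw [householderTau]
  split_ifs
  · rw [neg_sq, hsq]
  · exact hsq

theorem abs_householderTau_le : |householderTau p x| ≤ l2Norm x := by
  refine abs_le_of_sq_le_sq ?_ (l2Norm_nonneg x)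
  rw [sq_householderTau, l2Norm_sq]
  exact Finset.sum_le_univ_sum_of_nonneg fun i => sq_nonneg (x i)

theorem mul_householderTau_nonneg : 0 ≤ x p * householderTau p x := by
  rw [householderTau]
  split_ifs with hp
  · exact mul_nonneg_of_nonpos_of_nonpos hp.le (neg_nonpos.2 (Real.sqrt_nonneg _))
  · exact mul_nonneg (not_lt.1 hp) (Real.sqrt_nonneg _)

theorem householderVec_self : householderVec p x p = x p + householderTau p x := by
  simp [householderVec]

variable {p} in
theorem householderVec_of_gt {i : Fin s} (hi : p < i) : householderVec p x i = x i := by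
  simp [householderVec, hi.le, hi.ne']

variable {p} in
theorem householderVec_of_lt {i : Fin s} (hi : i < p) : householderVec p x i = 0 := by
  simp [householderVec, hi, hi.ne]

theorem householderVec_dotProduct (b : Fin s → ℝ) :
    householderVec p x ⬝ᵥ b = ∑ i ∈ Finset.Ici p, householderVec p x i * b i := by
  refine (Finset.sum_subset (Finset.subset_univ _) fun i _ hi => ?_).symm
  rw [householderVec_of_lt x (not_le.1 fun h => hi (Finset.mem_Ici.2 h)), zero_mul]

theorem householderVec_dotProduct_eq_add (b : Fin s → ℝ) :
    householderVec p x ⬝ᵥ b = ∑ i ∈ Finset.Ici p, x i * b i + householderTau p x * b p := by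
  have hIci : Finset.univ.filter (p ≤ ·) = Finset.Ici p := by ext; simp
  rw [householderVec, add_dotProduct, single_dotProduct]
  simp [dotProduct, Set.indicator_apply, ← Finset.sum_filter, hIci]

theorem householderVec_dotProduct_column :
    householderVec p x ⬝ᵥ x = householderTau p x * householderVec p x p := by
  rw [householderVec_dotProduct_eq_add, householderVec_self]
  simp only [← pow_two, ← sq_householderTau]
  ring

theorem householderVec_dotProduct_self :
    householderVec p x ⬝ᵥ householderVec p x =
      2 * (householderTau p x * householderVec p x p) := by
  have hcolumn := householderVec_dotProduct_column p x
  rw [householderVec_dotProduct] at hcolumn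
  rw [householderVec_dotProduct_eq_add, two_mul, ← hcolumn]
  simp only [mul_comm]

variable {p x}

theorem householderTau_mul_householderVec_pos (h : householderTau p x ≠ 0) :
    0 < householderTau p x * householderVec p x p := by
  rw [householderVec_self]
  nlinarith [mul_householderTau_nonneg p x, sq_pos_of_ne_zero h]

theorem householderCoeff_pos (h : householderTau p x ≠ 0) : 0 < householderCoeff p x :=
  one_div_pos.2 (householderTau_mul_householderVec_pos h)

theorem householderCoeff_mul_dotProduct_self (h : householderTau p x ≠ 0) :
    householderCoeff p x * (householderVec p x ⬝ᵥ householderVec p x) = 2 := by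
  rw [householderVec_dotProduct_self, householderCoeff, mul_left_comm,
    one_div_mul_cancel (householderTau_mul_householderVec_pos h).ne', mul_one]

theorem reflector_mulVec_column (h : householderTau p x ≠ 0) :
    reflector (householderCoeff p x) (householderVec p x) *ᵥ x = x - householderVec p x := by
  rw [reflector_mulVec, householderVec_dotProduct_column, householderCoeff,
    one_div_mul_cancel (householderTau_mul_householderVec_pos h).ne', one_smul]

end householderVec

section HouseholderStep

variable {s n : ℕ} {u : ℝ} {p : Fin s} {k : Fin n} {W W' : Matrix (Fin s) (Fin n) ℝ}
  {x b y v : Fin s → ℝ} {β β' τ : ℝ} {j kβ kv : ℕ}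

theorem reflector_mulVec_of_eq_zero (hb : ∀ i, p ≤ i → b i = 0) :
    reflector β (householderVec p x) *ᵥ b = b := by
  have hdot : householderVec p x ⬝ᵥ b = 0 := by
    rw [householderVec_dotProduct]
    exact Finset.sum_eq_zero fun i hi => by rw [hb i (Finset.mem_Ici.1 hi), mul_zero]
  rw [reflector_mulVec, hdot, mul_zero, zero_smul, sub_zero]

theorem l2Norm_pivot_sub_reflector_le (hu₀ : 0 ≤ u) (hu : u < 1) (hj : j * u < 1)
    (hx : householderTau p x ≠ 0) (hτ : RelApprox u j (householderTau p x) τ)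
    (habove : ∀ i, i < p → y i = x i) (hpivot : y p = -τ) (hbelow : ∀ i, p < i → y i = 0) :
    l2Norm (y - reflector (householderCoeff p x) (householderVec p x) *ᵥ x) ≤
      gam u j * l2Norm x := by
  have hdiff : y - reflector (householderCoeff p x) (householderVec p x) *ᵥ x =
      (householderTau p x - τ) • Pi.single p 1 := by
    rw [reflector_mulVec_column hx]
    ext i
    rcases lt_trichotomy i p with hi | rfl | hi
    · simp [habove i hi, householderVec_of_lt x hi, hi.ne]
    · simp only [Pi.sub_apply, hpivot, householderVec_self, Pi.smul_apply, Pi.single_eq_same,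
        smul_eq_mul]
      ring
    · simp [hbelow i hi, householderVec_of_gt x hi, hi.ne']
  rw [hdiff, l2Norm_smul, l2Norm_single_one, mul_one, abs_sub_comm]
  exact (hτ.abs_sub_le hu hj).trans
    (mul_le_mul_of_nonneg_left (abs_householderTau_le p x) (gam_nonneg hu₀ hj))

section update

variable {ι : Type} [DecidableEq ι] {I : Finset ι} {a c c' : ι → ℝ} {i : ι} {w t q r : ℝ}

theorem exists_relApprox_rank_one_term (hu₀ : 0 ≤ u) (hu : u < 1) (hβ : RelApprox u kβ β β')
    (hc : ∀ l ∈ I, RelApprox u kv (c l) (c' l)) (hw : FlDot u I c' a w) (ht : IsFl u (β' * w) t)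
    (hi : i ∈ I) (hq : IsFl u (t * c' i) q) :
    ∃ z : ι → ℝ, (∀ l ∈ I, RelApprox u (kβ + 2 * kv + I.card + 2) (β * (c l * a l) * c i) (z l)) ∧
      q = ∑ l ∈ I, z l := by
  obtain ⟨g, hg, rfl⟩ := hw.exists_relApprox hu₀ hu
  obtain ⟨ρ, hρ, rfl⟩ := (RelApprox.of_isFl hu ht).exists_factor
  obtain ⟨μ, hμ, rfl⟩ := (RelApprox.of_isFl hu hq).exists_factor
  refine ⟨fun l => β' * g l * ρ * c' i * μ, fun l hl => ?_, ?_⟩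
  · have hg' : RelApprox u (kv + I.card) (c l * a l) (g l) := by
      simpa using ((hc l hl).mul hu (.refl hu₀ hu 0 (a l))).trans hu (hg l hl)
    exact ((((hβ.mul hu hg').mul_factor hu hρ).mul hu (hc i hi)).mul_factor hu hμ).mono hu₀ hu
      (by omega)
  · simp only [Finset.mul_sum, Finset.sum_mul]

theorem abs_rank_one_update_sub_le (hu₀ : 0 ≤ u) (hu : u < 1)
    (hk : (kβ + 2 * kv + I.card + 3 : ℕ) * u < 1) (hβ : RelApprox u kβ β β')
    (hc : ∀ l ∈ I, RelApprox u kv (c l) (c' l)) (hw : FlDot u I c' a w) (ht : IsFl u (β' * w) t)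
    (hi : i ∈ I) (hq : IsFl u (t * c' i) q) (hr : IsFl u (a i - q) r) :
    |r - (a i - β * (∑ l ∈ I, c l * a l) * c i)| ≤
      gam u (kβ + 2 * kv + I.card + 3) * (|a i| + |β| * |c i| * ∑ l ∈ I, |c l| * |a l|) := by
  obtain ⟨z, hz, rfl⟩ := exists_relApprox_rank_one_term hu₀ hu hβ hc hw ht hi hq
  obtain ⟨ρ, hρ, rfl⟩ := (RelApprox.of_isFl hu hr).exists_factor
  have hfst : |a i * ρ - a i| ≤ gam u (kβ + 2 * kv + I.card + 3) * |a i| :=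
    RelApprox.abs_sub_le hu hk (by
      simpa using (RelApprox.refl hu₀ hu (kβ + 2 * kv + I.card + 2) (a i)).mul_factor hu hρ)
  have hsnd : |∑ l ∈ I, z l * ρ - ∑ l ∈ I, β * (c l * a l) * c i| ≤
      gam u (kβ + 2 * kv + I.card + 3) * ∑ l ∈ I, |β * (c l * a l) * c i| :=
    RelApprox.abs_sum_sub_sum_le hu hk fun l hl =>
      ((hz l hl).mul_factor hu hρ).mono hu₀ hu le_rfl
  have habs : ∑ l ∈ I, |β * (c l * a l) * c i| = |β| * |c i| * ∑ l ∈ I, |c l| * |a l| := by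
    rw [Finset.mul_sum]
    exact Finset.sum_congr rfl fun l _ => by simp only [abs_mul]; ring
  have hsplit : (a i - ∑ l ∈ I, z l) * ρ - (a i - β * (∑ l ∈ I, c l * a l) * c i) =
      (a i * ρ - a i) - (∑ l ∈ I, z l * ρ - ∑ l ∈ I, β * (c l * a l) * c i) := by
    rw [← Finset.sum_mul, ← Finset.sum_mul, ← Finset.mul_sum]
    ring
  rw [hsplit, mul_add, ← habs]
  exact (abs_sub _ _).trans (add_le_add hfst hsnd)

end update

theorem l2Norm_update_sub_reflector_le (hu₀ : 0 ≤ u) (hu : u < 1)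
    (hk : (kβ + 2 * kv + s + 3 : ℕ) * u < 1) (hx : householderTau p x ≠ 0)
    (hβ : RelApprox u kβ (householderCoeff p x) β)
    (hv : ∀ i, p ≤ i → RelApprox u kv (householderVec p x i) (v i))
    (habove : ∀ i, i < p → y i = b i)
    (hupdate : ∃ w t, FlDot u (Finset.Ici p) v b w ∧ IsFl u (β * w) t ∧
      ∀ i, p ≤ i → ∃ q, IsFl u (t * v i) q ∧ IsFl u (b i - q) (y i)) :
    l2Norm (y - reflector (householderCoeff p x) (householderVec p x) *ᵥ b) ≤
      3 * gam u (kβ + 2 * kv + s + 3) * l2Norm b := by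
  obtain ⟨w, t, hw, ht, hq⟩ := hupdate
  have hgam := gam_nonneg hu₀ hk
  have hcoeff := (householderCoeff_pos hx).le
  refine l2Norm_le_of_abs_le_reflector hcoeff (householderCoeff_mul_dotProduct_self hx) hgam
    fun i => ?_
  rw [reflector_mulVec, Pi.sub_apply, Pi.sub_apply, Pi.smul_apply, smul_eq_mul]
  rcases lt_or_ge i p with hi | hi
  · rw [habove i hi, householderVec_of_lt x hi, mul_zero, sub_zero, sub_self, abs_zero, mul_zero,
      zero_mul, add_zero]
    positivity
  · obtain ⟨q, hq, hy⟩ := hq i hi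
    have hcard : (Finset.Ici p).card ≤ s := by simp
    have hle : kβ + 2 * kv + (Finset.Ici p).card + 3 ≤ kβ + 2 * kv + s + 3 := by omega
    have hentry := abs_rank_one_update_sub_le hu₀ hu
      ((mul_le_mul_of_nonneg_right (Nat.cast_le.2 hle) hu₀).trans_lt hk) hβ
      (fun l hl => hv l (Finset.mem_Ici.1 hl)) hw ht (Finset.mem_Ici.2 hi) hq hy
    rw [← householderVec_dotProduct, abs_of_nonneg hcoeff] at hentry
    refine hentry.trans (mul_le_mul (gam_mono hu₀ hle hk) ?_ (by positivity) hgam)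
    gcongr
    exact Finset.subset_univ _

theorem FlNorm.relApprox_householderTau (hu₀ : 0 ≤ u) (hu : u < 1) {σ : ℝ}
    (h : FlNorm u (Finset.Ici p) x σ) :
    RelApprox u (s + 1) (householderTau p x) (if x p < 0 then -σ else σ) := by
  have hcard : (Finset.Ici p).card + 1 ≤ s + 1 := by simp
  have hσ := (h.relApprox hu₀ hu).mono hu₀ hu hcard
  rw [householderTau]
  split_ifs
  · exact hσ.neg
  · exact hσ

theorem FlNorm.eq_zero_iff_householderTau (hu₀ : 0 ≤ u) (hu : u < 1) {σ : ℝ}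
    (h : FlNorm u (Finset.Ici p) x σ) : σ = 0 ↔ householderTau p x = 0 := by
  rw [← (h.relApprox_householderTau hu₀ hu).eq_zero_iff hu]
  split_ifs
  · exact neg_eq_zero.symm
  · rfl

theorem HouseholderStep.eq_of_householderTau_eq_zero (hu₀ : 0 ≤ u) (hu : u < 1)
    (h : HouseholderStep u p k W W') (hτ : householderTau p (W.col k) = 0) : W' = W := by
  obtain ⟨σ, hσ, ⟨-, hW⟩ | ⟨hne, -⟩⟩ := h
  · exact hW
  · exact absurd ((FlNorm.eq_zero_iff_householderTau hu₀ hu hσ).2 hτ) hne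

theorem HouseholderStep.exists_relApprox (hu₀ : 0 ≤ u) (hu : u < 1)
    (h : HouseholderStep u p k W W') (hτ : householderTau p (W.col k) ≠ 0) :
    ∃ (τ β : ℝ) (v : Fin s → ℝ),
      RelApprox u (s + 1) (householderTau p (W.col k)) τ ∧
      (∀ i, p ≤ i → RelApprox u (s + 2) (householderVec p (W.col k) i) (v i)) ∧
      RelApprox u (2 * s + 5) (householderCoeff p (W.col k)) β ∧
      (∀ i j, i < p ∨ j < k → W' i j = W i j) ∧ W' p k = -τ ∧ (∀ i, p < i → W' i k = 0) ∧
      ∀ j, k < j → ∃ w t, FlDot u (Finset.Ici p) v (W.col j) w ∧ IsFl u (β * w) t ∧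
        ∀ i, p ≤ i → ∃ q, IsFl u (t * v i) q ∧ IsFl u (W i j - q) (W' i j) := by
  obtain ⟨σ, hσ, ⟨hzero, -⟩ | ⟨-, τ, d, β, v, rfl, hvp, hvi, hd, hβ, hsame, hpivot, helim, hupd⟩⟩ :=
    h
  · exact absurd ((FlNorm.eq_zero_iff_householderTau hu₀ hu hσ).1 hzero) hτ
  have hτ' := FlNorm.relApprox_householderTau hu₀ hu hσ
  have hvp' : RelApprox u (s + 2) (householderVec p (W.col k) p) (v p) := by
    rw [householderVec_self]
    exact ((RelApprox.add_of_mul_nonneg hu₀ hu (mul_householderTau_nonneg p (W.col k))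
      (.refl hu₀ hu _ _) hτ').trans hu (.of_isFl hu hvp)).mono hu₀ hu le_rfl
  refine ⟨_, β, v, hτ', fun i hi => ?_, ?_, hsame, hpivot, helim, hupd⟩
  · rcases hi.eq_or_lt with rfl | hi
    · exact hvp'
    · rw [householderVec_of_gt _ hi, hvi i hi]
      exact .refl hu₀ hu _ _
  · have hd' := ((hτ'.mul hu hvp').trans hu (.of_isFl hu hd)).inv hu
    rw [householderCoeff, one_div]
    rw [one_div] at hβ
    exact (hd'.trans hu (.of_isFl hu hβ)).mono hu₀ hu (by omega)

theorem HouseholderStep.apply_of_lt (h : HouseholderStep u p k W W') (i : Fin s) {j : Fin n}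
    (hj : j < k) : W' i j = W i j := by
  obtain ⟨σ, -, ⟨-, rfl⟩ | ⟨-, τ, d, β, v, -, -, -, -, -, hsame, -⟩⟩ := h
  · rfl
  · exact hsame i j (.inr hj)

theorem HouseholderStep.apply_eq_zero (hu₀ : 0 ≤ u) (hu : u < 1) (h : HouseholderStep u p k W W')
    {i : Fin s} (hi : p < i) : W' i k = 0 := by
  by_cases hτ : householderTau p (W.col k) = 0
  · have hsum := sq_householderTau p (W.col k)
    rw [hτ, zero_pow two_ne_zero, eq_comm, Finset.sum_eq_zero_iff_of_nonneg fun i _ => sq_nonneg _]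
      at hsum
    rw [h.eq_of_householderTau_eq_zero hu₀ hu hτ]
    exact pow_eq_zero_iff two_ne_zero |>.1 (hsum i (Finset.mem_Ici.2 hi.le))
  · obtain ⟨τ, β, v, -, -, -, -, -, helim, -⟩ := h.exists_relApprox hu₀ hu hτ
    exact helim i hi

theorem HouseholderStep.exists_orthogonal (hu₀ : 0 ≤ u) (hu : u < 1)
    (hs : (5 * s + 12 : ℕ) * u < 1) (h : HouseholderStep u p k W W')
    (hW : ∀ i j, p ≤ i → j < k → W i j = 0) :
    ∃ P ∈ orthogonalGroup (Fin s) ℝ, ∀ j,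
      l2Norm (W'.col j - P *ᵥ W.col j) ≤ 3 * gam u (5 * s + 12) * l2Norm (W.col j) := by
  have hgam := gam_nonneg hu₀ hs
  by_cases hτ : householderTau p (W.col k) = 0
  · refine ⟨1, one_mem _, fun j => ?_⟩
    rw [h.eq_of_householderTau_eq_zero hu₀ hu hτ, one_mulVec, sub_self, l2Norm_zero]
    exact mul_nonneg (by positivity) (l2Norm_nonneg _)
  refine ⟨_, reflector_mem_orthogonalGroup (householderCoeff_mul_dotProduct_self hτ), fun j => ?_⟩
  obtain ⟨τ, β, v, hτ', hv, hβ, hsame, hpivot, helim, hupd⟩ := h.exists_relApprox hu₀ hu hτ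
  rcases lt_trichotomy j k with hj | rfl | hj
  · have hcol : W'.col j = W.col j := funext fun i => hsame i j (.inr hj)
    rw [reflector_mulVec_of_eq_zero (b := W.col j) fun i hi => hW i j hi hj, hcol, sub_self,
      l2Norm_zero]
    exact mul_nonneg (by positivity) (l2Norm_nonneg _)
  · refine (l2Norm_pivot_sub_reflector_le hu₀ hu hs hτ (hτ'.mono hu₀ hu (by omega))
      (fun i hi => hsame i j (.inl hi)) hpivot helim).trans
      (mul_le_mul_of_nonneg_right (by linarith) (l2Norm_nonneg _))
  · have hcounter : 2 * s + 5 + 2 * (s + 2) + s + 3 = 5 * s + 12 := by ring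
    rw [← hcounter] at hs ⊢
    exact l2Norm_update_sub_reflector_le hu₀ hu hs hτ hβ hv
      (fun i hi => hsame i j (.inl hi)) (hupd j hj)

end HouseholderStep

section Accumulation

theorem l2Norm_mulVec_of_mem_orthogonalGroup {ι : Type*} [Fintype ι] [DecidableEq ι]
    {Q : Matrix ι ι ℝ} (hQ : Q ∈ orthogonalGroup ι ℝ) (x : ι → ℝ) :
    l2Norm (Q *ᵥ x) = l2Norm x :=
  l2Norm_mulVec_of_transpose_mul_self ((mem_orthogonalGroup_iff' ι ℝ).1 hQ) x

theorem exists_orthogonal_l2Norm_sub_le {ι κ : Type*} [Fintype ι] [DecidableEq ι] {ε : ℝ}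
    (hε : 0 ≤ ε) {W : ℕ → Matrix ι κ ℝ} {n : ℕ}
    (h : ∀ k < n, ∃ P ∈ orthogonalGroup ι ℝ, ∀ j,
      l2Norm ((W (k + 1)).col j - P *ᵥ (W k).col j) ≤ ε * l2Norm ((W k).col j)) :
    ∃ Q ∈ orthogonalGroup ι ℝ, ∀ j,
      l2Norm ((W n).col j - Q *ᵥ (W 0).col j) ≤ ((1 + ε) ^ n - 1) * l2Norm ((W 0).col j) := by
  induction n with
  | zero => exact ⟨1, one_mem _, by simp⟩
  | succ k ih =>
    obtain ⟨Q, hQ, hWQ⟩ := ih fun i hi => h i (hi.trans k.lt_succ_self)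
    obtain ⟨P, hP, hWP⟩ := h k k.lt_succ_self
    refine ⟨P * Q, mul_mem hP hQ, fun j => ?_⟩
    set b := (W 0).col j
    set w := (W k).col j
    have hsplit : (W (k + 1)).col j - (P * Q) *ᵥ b =
        ((W (k + 1)).col j - P *ᵥ w) + P *ᵥ (w - Q *ᵥ b) := by
      rw [mulVec_sub, mulVec_mulVec]
      abel
    have hw : l2Norm w ≤ l2Norm b + l2Norm (w - Q *ᵥ b) := by
      simpa only [l2Norm_mulVec_of_mem_orthogonalGroup hQ] using l2Norm_le_add_sub w (Q *ᵥ b)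
    calc l2Norm ((W (k + 1)).col j - (P * Q) *ᵥ b)
        ≤ l2Norm ((W (k + 1)).col j - P *ᵥ w) + l2Norm (w - Q *ᵥ b) := by
          rw [hsplit]
          exact (l2Norm_add_le _ _).trans_eq (by rw [l2Norm_mulVec_of_mem_orthogonalGroup hP])
      _ ≤ ε * (l2Norm b + l2Norm (w - Q *ᵥ b)) + l2Norm (w - Q *ᵥ b) := by
          gcongr
          exact (hWP j).trans (mul_le_mul_of_nonneg_left hw hε)
      _ = ε * l2Norm b + (1 + ε) * l2Norm (w - Q *ᵥ b) := by ring
      _ ≤ ε * l2Norm b + (1 + ε) * (((1 + ε) ^ k - 1) * l2Norm b) := by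
          gcongr
          exact hWQ j
      _ = ((1 + ε) ^ (k + 1) - 1) * l2Norm b := by ring

theorem exists_backward_error_of_orthogonal {s n : ℕ} {ε : ℝ} (hε : 0 ≤ ε)
    {Q : Matrix (Fin s) (Fin s) ℝ} (hQ : Q ∈ orthogonalGroup (Fin s) ℝ)
    {V B : Matrix (Fin s) (Fin n) ℝ}
    (h : ∀ j, l2Norm (V.col j - Q *ᵥ B.col j) ≤ ε * l2Norm (B.col j)) :
    ∃ E, Vᵀ * V = (B + E)ᵀ * (B + E) ∧ frobNorm E ≤ ε * frobNorm B := by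
  have hQQ : Q * Qᵀ = 1 := (mem_orthogonalGroup_iff (Fin s) ℝ).1 hQ
  have hQt : Qᵀ ∈ orthogonalGroup (Fin s) ℝ := Unitary.star_mem hQ
  refine ⟨Qᵀ * V - B, ?_, frobNorm_le_of_col_le hε fun j => ?_⟩
  · rw [add_sub_cancel, transpose_mul, transpose_transpose, Matrix.mul_assoc, ← Matrix.mul_assoc Q,
      hQQ, Matrix.one_mul]
  · have hcol : (Qᵀ * V - B).col j = Qᵀ *ᵥ (V.col j - Q *ᵥ B.col j) := by
      rw [mulVec_sub, mulVec_mulVec, (mem_orthogonalGroup_iff' (Fin s) ℝ).1 hQ, one_mulVec]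
      rfl
    rw [hcol, l2Norm_mulVec_of_mem_orthogonalGroup hQt]
    exact h j

theorem transpose_mul_self_submatrix_castLE {n q s : ℕ} (hns : n ≤ s)
    {V : Matrix (Fin s) (Fin q) ℝ} (hV : ∀ i j, n ≤ i.1 → V i j = 0) :
    (V.submatrix (Fin.castLE hns) id)ᵀ * V.submatrix (Fin.castLE hns) id = Vᵀ * V := by
  ext j k
  simp only [mul_apply, transpose_apply, submatrix_apply, id]
  refine Fintype.sum_of_injective _ (Fin.castLE_injective hns) _ _ (fun i hi => ?_) fun _ => rfl
  rw [hV i j (not_lt.1 fun h => hi ⟨⟨i, h⟩, rfl⟩), zero_mul]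

variable {n s : ℕ} {u : ℝ} {W : ℕ → Matrix (Fin s) (Fin n) ℝ}

theorem HouseholderStep.iterate_apply_eq_zero (hu₀ : 0 ≤ u) (hu : u < 1) (hns : n ≤ s)
    (h : ∀ k : Fin n, HouseholderStep u (Fin.castLE hns k) k (W k) (W (k + 1))) {k : ℕ}
    (hk : k ≤ n) {i : Fin s} {j : Fin n} (hjk : j < k) (hji : j.1 < i.1) : W k i j = 0 := by
  induction k with
  | zero => exact absurd hjk j.1.not_lt_zero
  | succ k ih =>
    have hstep : HouseholderStep u (Fin.castLE hns ⟨k, hk⟩) ⟨k, hk⟩ (W k) (W (k + 1)) := h ⟨k, hk⟩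
    rcases Nat.lt_succ_iff_lt_or_eq.1 hjk with hlt | heq
    · rw [hstep.apply_of_lt i (Fin.lt_def.2 hlt)]
      exact ih (Nat.le_of_succ_le hk) hlt
    · obtain rfl : j = ⟨k, hk⟩ := Fin.ext heq
      exact hstep.apply_eq_zero hu₀ hu (Fin.lt_def.2 hji)

theorem one_add_three_mul_gam_pow_le (hu₀ : 0 ≤ u) (hs : 0 < s) (hk : (n * (51 * s) : ℕ) * u < 1)
    (hn : 0 < n) : (1 + 3 * gam u (5 * s + 12)) ^ n ≤ 1 + gam u (n * (51 * s)) := by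
  have hle : 3 * (5 * s + 12) ≤ 51 * s := by omega
  have h51 : (51 * s : ℕ) * u < 1 :=
    (mul_le_mul_of_nonneg_right (Nat.cast_le.2 (Nat.le_mul_of_pos_left _ hn)) hu₀).trans_lt hk
  have h3 : (3 * (5 * s + 12) : ℕ) * u < 1 :=
    (mul_le_mul_of_nonneg_right (Nat.cast_le.2 hle) hu₀).trans_lt h51
  have h1 : (5 * s + 12 : ℕ) * u < 1 :=
    (mul_le_mul_of_nonneg_right (Nat.cast_le.2 (by omega)) hu₀).trans_lt h3
  have hgam := gam_nonneg hu₀ h1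
  calc (1 + 3 * gam u (5 * s + 12)) ^ n ≤ (1 + gam u (51 * s)) ^ n := by
        gcongr
        exact (mul_gam_le hu₀ h3).trans (gam_mono hu₀ hle h51)
    _ ≤ 1 + gam u (n * (51 * s)) := one_add_gam_pow_le hu₀ hk

variable {hns : n ≤ s} {B : Matrix (Fin s) (Fin n) ℝ} {R : Matrix (Fin n) (Fin n) ℝ}

theorem FlHouseholderR.isUpperTriangular (hu₀ : 0 ≤ u) (hu : u < 1)
    (h : FlHouseholderR u hns B R) : R.IsUpperTriangular := by
  obtain ⟨W, -, hstep, hR⟩ := h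
  intro i j hij
  rw [hR]
  exact HouseholderStep.iterate_apply_eq_zero hu₀ hu hns hstep le_rfl j.2 hij

theorem FlHouseholderR.exists_backward_error {c : ℕ} (hc : 51 ≤ c) (hn : 0 < n) (hu₀ : 0 ≤ u)
    (hk : (c * s * n : ℕ) * u < 1) (h : FlHouseholderR u hns B R) :
    ∃ E : Matrix (Fin s) (Fin n) ℝ, Rᵀ * R = (B + E)ᵀ * (B + E) ∧
      frobNorm E ≤ gam u (c * s * n) * frobNorm B := by
  have hs := hn.trans_le hns
  have hle : n * (51 * s) ≤ c * s * n := by nlinarith [Nat.mul_le_mul_right (s * n) hc]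
  have hk' : (n * (51 * s) : ℕ) * u < 1 :=
    (mul_le_mul_of_nonneg_right (Nat.cast_le.2 hle) hu₀).trans_lt hk
  have hstep_counter : (5 * s + 12 : ℕ) * u < 1 :=
    (mul_le_mul_of_nonneg_right (Nat.cast_le.2 (by nlinarith)) hu₀).trans_lt hk'
  have hu : u < 1 := (le_mul_of_one_le_left hu₀ (by exact_mod_cast Nat.le_add_left 1 _)).trans_lt
    hstep_counter
  obtain ⟨W, rfl, hstep, hR⟩ := h
  have hzero (k : ℕ) (hk : k ≤ n) (i : Fin s) (j : Fin n) (hjk : j < k) (hji : j.1 < i.1) :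
      W k i j = 0 :=
    HouseholderStep.iterate_apply_eq_zero hu₀ hu hns hstep hk hjk hji
  obtain ⟨Q, hQ, hWQ⟩ := exists_orthogonal_l2Norm_sub_le (n := n) (W := W)
    (mul_nonneg zero_le_three (gam_nonneg hu₀ hstep_counter)) fun k hk =>
      (hstep ⟨k, hk⟩).exists_orthogonal hu₀ hu hstep_counter fun i j hi hj =>
        hzero k hk.le i j hj (lt_of_lt_of_le hj hi)
  have htop : R = (W n).submatrix (Fin.castLE hns) id := by ext; exact hR _ _
  rw [htop, transpose_mul_self_submatrix_castLE hns fun i j hi =>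
    hzero n le_rfl i j j.2 (j.2.trans_le hi)]
  refine exists_backward_error_of_orthogonal (gam_nonneg hu₀ hk) hQ fun j =>
    (hWQ j).trans (mul_le_mul_of_nonneg_right ?_ (l2Norm_nonneg _))
  linarith [one_add_three_mul_gam_pow_le hu₀ hs hk' hn, gam_mono hu₀ hle hk]

end Accumulation

/-! ### Matrix product and forward substitution -/

section FlMul

variable {m n s : ℕ} {u : ℝ}

theorem FlMul.frobNorm_sub_le {M : Matrix (Fin s) (Fin m) ℝ} {N : Matrix (Fin m) (Fin n) ℝ}
    {P : Matrix (Fin s) (Fin n) ℝ} (hu₀ : 0 ≤ u) (hu : u < 1) (hm : m * u < 1)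
    (h : FlMul u M N P) : frobNorm (P - M * N) ≤ gam u m * (frobNorm M * frobNorm N) := by
  refine frobNorm_le_of_abs_le_mul_sum (gam_nonneg hu₀ hm) fun i j => ?_
  simpa only [Finset.card_univ, Fintype.card_fin, Matrix.sub_apply, mul_apply] using
    (h i j).abs_sub_le hu₀ hu (by simpa)

end FlMul

section FlForwardSubst

variable {m n : ℕ} {u : ℝ} {R : Matrix (Fin n) (Fin n) ℝ}

theorem FlForwardSubst.exists_relApprox (hu₀ : 0 ≤ u) (hu : u < 1) {a y : Fin n → ℝ}
    (h : FlForwardSubst u R a y) {i : Fin n} (hR : R i i ≠ 0) :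
    ∃ z : Fin n → ℝ, (∀ j ≤ i, RelApprox u (2 * n) (y j * R j i) (z j)) ∧
      a i = ∑ j ∈ Finset.Iic i, z j := by
  obtain ⟨p, t, hp, ht, hy⟩ := h i
  obtain ⟨g, hg, rfl⟩ := ht.exists_relApprox hu₀ hu
  set t := ∑ j ∈ Finset.Iic i, g j
  have hcounter : (Finset.Iic i).card - 1 ≤ n - 1 := by simp; omega
  obtain ⟨ρ, hρ, hgi⟩ := ((hg i).mono hu₀ hu hcounter).exists_factor
  rw [if_pos rfl] at hgi
  have hρinv : RelApprox u (n - 1) 1 ρ⁻¹ := by simpa using hρ.inv hu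
  have hρ₀ : ρ ≠ 0 := fun h => one_ne_zero ((hρ.eq_zero_iff hu).1 h)
  refine ⟨fun j => (if j = i then t else -g j) * ρ⁻¹, fun j hj => ?_, ?_⟩
  · rcases hj.eq_or_lt with rfl | hj
    · have hty : RelApprox u 1 (y j * R j j) t := by
        simpa [hR] using ((RelApprox.of_isFl hu hy).symm hu).mul hu (.refl hu₀ hu 0 (R j j))
      simpa using (hty.mul_factor hu hρinv).mono hu₀ hu (by omega)
    · have hgj := ((hg j).mono hu₀ hu hcounter).neg
      rw [if_neg hj.ne, neg_neg] at hgj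
      simp only [if_neg hj.ne, mul_comm (y j)]
      exact (((RelApprox.of_isFl hu (hp j hj)).trans hu hgj).mul_factor hu hρinv).mono hu₀ hu
        (by omega)
  · have hlower : ∑ j ∈ Finset.Iio i, (if j = i then t else -g j) = -∑ j ∈ Finset.Iio i, g j := by
      rw [← Finset.sum_neg_distrib]
      exact Finset.sum_congr rfl fun j hj => if_neg (Finset.mem_Iio.1 hj).ne
    have ht : t = g i + ∑ j ∈ Finset.Iio i, g j := by
      rw [← Finset.sum_insert (by simp), Finset.Iio_insert]
    rw [← Finset.sum_mul, ← Finset.Iio_insert, Finset.sum_insert (by simp), if_pos rfl, hlower, ht,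
      add_neg_cancel_right, hgi, mul_inv_cancel_right₀ hρ₀]

theorem FlForwardSubst.abs_sub_le (hu₀ : 0 ≤ u) (hu : u < 1) (hn : (2 * n : ℕ) * u < 1)
    (hR : R.IsUpperTriangular) (hdiag : ∀ i, R i i ≠ 0) {a y : Fin n → ℝ}
    (h : FlForwardSubst u R a y) (i : Fin n) :
    |a i - ∑ j, y j * R j i| ≤ gam u (2 * n) * ∑ j, |y j| * |R j i| := by
  obtain ⟨z, hz, ha⟩ := h.exists_relApprox hu₀ hu (hdiag i)
  have hsum (f : Fin n → ℝ) (hf : ∀ j, R j i = 0 → f j = 0) :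
      ∑ j, f j = ∑ j ∈ Finset.Iic i, f j :=
    (Finset.sum_subset (Finset.subset_univ _) fun j _ hj =>
      hf j (hR (not_le.1 fun hle => hj (Finset.mem_Iic.2 hle)))).symm
  rw [ha, hsum _ fun j hj => by rw [hj, mul_zero],
    hsum _ fun j hj => by rw [hj, abs_zero, mul_zero]]
  simpa only [abs_mul] using
    RelApprox.abs_sum_sub_sum_le hu hn fun j hj => hz j (Finset.mem_Iic.1 hj)

theorem FlRightSolve.specNorm_sub_le (hu₀ : 0 ≤ u) (hu : u < 1) (hn : (2 * n : ℕ) * u < 1)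
    (hR : R.IsUpperTriangular) (hdiag : ∀ i, R i i ≠ 0) {A Y : Matrix (Fin m) (Fin n) ℝ}
    (h : FlRightSolve u A R Y) :
    specNorm (A - Y * R) ≤ n * gam u (2 * n) * (specNorm Y * specNorm R) := by
  have hgam := gam_nonneg hu₀ hn
  calc specNorm (A - Y * R) ≤ frobNorm (A - Y * R) := specNorm_le_frobNorm _
    _ ≤ gam u (2 * n) * (frobNorm Y * frobNorm R) :=
        frobNorm_le_of_abs_le_mul_sum hgam fun i j => (h i).abs_sub_le hu₀ hu hn hR hdiag j
    _ ≤ gam u (2 * n) * ((√n * specNorm Y) * (√n * specNorm R)) := by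
        have := specNorm_nonneg Y
        have := frobNorm_nonneg R
        gcongr <;> exact frobNorm_le_sqrt_mul_specNorm _
    _ = n * gam u (2 * n) * (specNorm Y * specNorm R) := by
        linear_combination gam u (2 * n) * specNorm Y * specNorm R *
          Real.mul_self_sqrt (Nat.cast_nonneg (α := ℝ) n)

end FlForwardSubst

/-! ### Conditioning of the preconditioned matrix -/

section LinearIndependent

variable {l m n : ℕ}

theorem linearIndependent_col_of_l2Norm_mulVec_le {A : Matrix (Fin l) (Fin n) ℝ}
    {N : Matrix (Fin m) (Fin n) ℝ} {C : ℝ} (hA : LinearIndependent ℝ A.col)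
    (h : ∀ x, l2Norm (A *ᵥ x) ≤ C * l2Norm (N *ᵥ x)) : LinearIndependent ℝ N.col := by
  rw [← mulVec_injective_iff] at hA ⊢
  refine (injective_iff_map_eq_zero N.mulVecLin).2 fun x hx => ?_
  have hle := h x
  rw [show N *ᵥ x = 0 from hx, l2Norm_zero, mul_zero] at hle
  refine (injective_iff_map_eq_zero A.mulVecLin).1 hA x ?_
  exact l2Norm_eq_zero.1 (hle.antisymm (l2Norm_nonneg _))

theorem linearIndependent_col_of_mul_right {M : Matrix (Fin l) (Fin m) ℝ}
    {N : Matrix (Fin m) (Fin n) ℝ} (h : LinearIndependent ℝ (M * N).col) :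
    LinearIndependent ℝ N.col := by
  rw [← mulVec_injective_iff] at h ⊢
  refine Function.Injective.of_comp (f := M.mulVec) ?_
  simpa only [Function.comp_def, mulVec_mulVec] using h

theorem isUnit_of_linearIndependent_col {T : Matrix (Fin n) (Fin n) ℝ}
    (h : LinearIndependent ℝ T.col) : IsUnit T :=
  mulVec_injective_iff_isUnit.1 (mulVec_injective_iff.2 h)

theorem linearIndependent_col_of_mul_left {M : Matrix (Fin m) (Fin n) ℝ}
    {T : Matrix (Fin n) (Fin n) ℝ} (h : LinearIndependent ℝ (M * T).col) :
    LinearIndependent ℝ M.col := by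
  have hT := isUnit_of_linearIndependent_col (linearIndependent_col_of_mul_right h)
  rw [← mulVec_injective_iff] at h ⊢
  refine Function.Injective.of_comp_right (g := T.mulVec) ?_ (mulVec_surjective_iff_isUnit.2 hT)
  simpa only [Function.comp_def, mulVec_mulVec] using h

theorem apply_self_ne_zero_of_isUpperTriangular {T : Matrix (Fin n) (Fin n) ℝ}
    (hT : T.IsUpperTriangular) (h : LinearIndependent ℝ T.col) (i : Fin n) : T i i ≠ 0 := by
  have hdet := (isUnit_iff_isUnit_det T).1 (isUnit_of_linearIndependent_col h)
  rw [det_of_isUpperTriangular hT] at hdet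
  exact Finset.prod_ne_zero_iff.1 hdet.ne_zero i (Finset.mem_univ i)

end LinearIndependent

section conditioning

variable {m n s : ℕ}

theorem cond2_le_kS (S : Matrix (Fin s) (Fin m) ℝ) {Q : Matrix (Fin m) (Fin n) ℝ}
    (hQ : Qᵀ * Q = 1) : cond2 (S * Q) ≤ kS S Q := by
  refine mul_le_mul_of_nonneg_right (specNorm_le (specNorm_nonneg _) fun x => ?_)
    (specNorm_nonneg _)
  rw [← mulVec_mulVec, ← l2Norm_mulVec_of_transpose_mul_self hQ x]
  exact l2Norm_mulVec_le _ _

variable {A Q : Matrix (Fin m) (Fin n) ℝ} {T R : Matrix (Fin n) (Fin n) ℝ}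
  {S : Matrix (Fin s) (Fin m) ℝ}

theorem l2Norm_mulVec_le_specNorm_pinv_mul (hQ : Qᵀ * Q = 1)
    (hSQ : LinearIndependent ℝ (S * Q).col) (x : Fin n → ℝ) :
    l2Norm ((Q * T) *ᵥ x) ≤ specNorm (pinv (S * Q)) * l2Norm ((S * (Q * T)) *ᵥ x) := by
  have h := l2Norm_le_specNorm_pinv_mul hSQ (T *ᵥ x)
  rwa [← l2Norm_mulVec_of_transpose_mul_self hQ, mulVec_mulVec, mulVec_mulVec,
    Matrix.mul_assoc] at h

theorem specNorm_pinv_mul_l2Norm_mulVec_le (hQ : Qᵀ * Q = 1) (x : Fin n → ℝ) :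
    specNorm (pinv (S * Q)) * l2Norm ((S * (Q * T)) *ᵥ x) ≤
      cond2 (S * Q) * l2Norm ((Q * T) *ᵥ x) := by
  have h := l2Norm_mulVec_le (S * Q) (T *ᵥ x)
  rw [← l2Norm_mulVec_of_transpose_mul_self hQ, mulVec_mulVec, mulVec_mulVec,
    Matrix.mul_assoc] at h
  calc specNorm (pinv (S * Q)) * l2Norm ((S * (Q * T)) *ᵥ x)
      ≤ specNorm (pinv (S * Q)) * (specNorm (S * Q) * l2Norm ((Q * T) *ᵥ x)) :=
        mul_le_mul_of_nonneg_left h (specNorm_nonneg _)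
    _ = cond2 (S * Q) * l2Norm ((Q * T) *ᵥ x) := by rw [cond2]; ring

theorem l2Norm_mulVec_perturbation_le {E : Matrix (Fin s) (Fin n) ℝ} {g δ : ℝ} (hg : 0 ≤ g)
    (hA : LinearIndependent ℝ A.col) (hE : specNorm E ≤ δ)
    (hδ : 3 * (g * δ * specNorm (pinv A)) ≤ 1) (x : Fin n → ℝ) :
    3 * (g * l2Norm (E *ᵥ x)) ≤ l2Norm (A *ᵥ x) :=
  calc 3 * (g * l2Norm (E *ᵥ x)) ≤ 3 * (g * (δ * (specNorm (pinv A) * l2Norm (A *ᵥ x)))) := by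
        gcongr
        exact (l2Norm_mulVec_le E x).trans (mul_le_mul hE (l2Norm_le_specNorm_pinv_mul hA x)
          (l2Norm_nonneg x) ((specNorm_nonneg E).trans hE))
    _ = 3 * (g * δ * specNorm (pinv A)) * l2Norm (A *ᵥ x) := by ring
    _ ≤ l2Norm (A *ᵥ x) := mul_le_of_le_one_left (l2Norm_nonneg _) hδ

theorem two_mul_l2Norm_mulVec_le {M E : Matrix (Fin s) (Fin n) ℝ} {g : ℝ} (hg : 0 ≤ g)
    (hM : ∀ x, l2Norm (A *ᵥ x) ≤ g * l2Norm (M *ᵥ x))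
    (hE : ∀ x, 3 * (g * l2Norm (E *ᵥ x)) ≤ l2Norm (A *ᵥ x))
    (hR : Rᵀ * R = (M + E)ᵀ * (M + E)) (x : Fin n → ℝ) :
    2 * l2Norm (A *ᵥ x) ≤ 3 * g * l2Norm (R *ᵥ x) := by
  have htriangle : l2Norm (M *ᵥ x) ≤ l2Norm (R *ᵥ x) + l2Norm (E *ᵥ x) := by
    have := l2Norm_le_add_sub (M *ᵥ x) ((M + E) *ᵥ x)
    rwa [l2Norm_sub_comm, ← sub_mulVec, add_sub_cancel_left,
      ← l2Norm_mulVec_eq_of_transpose_mul_eq hR] at this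
  linarith [hM x, hE x, mul_le_mul_of_nonneg_left htriangle hg]

theorem three_mul_l2Norm_mulVec_le {M E : Matrix (Fin s) (Fin n) ℝ} {g κ : ℝ} (hg : 0 ≤ g)
    (hM : ∀ x, g * l2Norm (M *ᵥ x) ≤ κ * l2Norm (A *ᵥ x))
    (hE : ∀ x, 3 * (g * l2Norm (E *ᵥ x)) ≤ l2Norm (A *ᵥ x))
    (hR : Rᵀ * R = (M + E)ᵀ * (M + E)) (x : Fin n → ℝ) :
    3 * g * l2Norm (R *ᵥ x) ≤ (3 * κ + 1) * l2Norm (A *ᵥ x) := by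
  have htriangle : l2Norm (R *ᵥ x) ≤ l2Norm (M *ᵥ x) + l2Norm (E *ᵥ x) := by
    rw [l2Norm_mulVec_eq_of_transpose_mul_eq hR, add_mulVec]
    exact l2Norm_add_le _ _
  linarith [hM x, hE x, mul_le_mul_of_nonneg_left htriangle hg]

variable {Y : Matrix (Fin m) (Fin n) ℝ} {g κ η : ℝ}

theorem l2Norm_residual_le (hg : 0 < g) (hκ : 1 ≤ κ) (hη : 0 ≤ η)
    (hA : LinearIndependent ℝ A.col)
    (hup : ∀ x, 3 * g * l2Norm (R *ᵥ x) ≤ (3 * κ + 1) * l2Norm (A *ᵥ x))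
    (hres : specNorm (A - Y * R) ≤ η * (specNorm Y * specNorm R))
    (hsmall : 8 * η * κ * cond2 A ≤ 1) (x : Fin n → ℝ) :
    6 * g * l2Norm (A *ᵥ x - Y *ᵥ (R *ᵥ x)) ≤ specNorm Y * l2Norm (A *ᵥ x) := by
  have hY := specNorm_nonneg Y
  have hA₀ := specNorm_nonneg A
  have hAdag := specNorm_nonneg (pinv A)
  have hAx := l2Norm_nonneg (A *ᵥ x)
  have hR : 3 * g * specNorm R ≤ 4 * κ * specNorm A := by
    rw [← le_div_iff₀' (by positivity)]
    refine specNorm_le (by positivity) fun z => ?_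
    rw [div_mul_eq_mul_div, le_div_iff₀' (by positivity), mul_assoc (4 * κ)]
    exact (hup z).trans (mul_le_mul (by linarith) (l2Norm_mulVec_le A z) (l2Norm_nonneg _)
      (by positivity))
  calc 6 * g * l2Norm (A *ᵥ x - Y *ᵥ (R *ᵥ x)) = 6 * g * l2Norm ((A - Y * R) *ᵥ x) := by
        rw [sub_mulVec, mulVec_mulVec]
    _ ≤ 6 * g * (η * (specNorm Y * specNorm R) * (specNorm (pinv A) * l2Norm (A *ᵥ x))) := by
        gcongr
        exact (l2Norm_mulVec_le _ x).trans (mul_le_mul hres (l2Norm_le_specNorm_pinv_mul hA x)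
          (l2Norm_nonneg x) ((specNorm_nonneg _).trans hres))
    _ = 2 * η * specNorm Y * (3 * g * specNorm R) * (specNorm (pinv A) * l2Norm (A *ᵥ x)) := by
        ring
    _ ≤ 2 * η * specNorm Y * (4 * κ * specNorm A) * (specNorm (pinv A) * l2Norm (A *ᵥ x)) := by
        gcongr
    _ = 8 * η * κ * cond2 A * (specNorm Y * l2Norm (A *ᵥ x)) := by rw [cond2]; ring
    _ ≤ specNorm Y * l2Norm (A *ᵥ x) := mul_le_of_le_one_left (by positivity) hsmall

theorem specNorm_le_two_mul (hg : 0 < g) (hR : IsUnit R)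
    (hlow : ∀ x, 2 * l2Norm (A *ᵥ x) ≤ 3 * g * l2Norm (R *ᵥ x))
    (hres : ∀ x, 6 * g * l2Norm (A *ᵥ x - Y *ᵥ (R *ᵥ x)) ≤ specNorm Y * l2Norm (A *ᵥ x)) :
    specNorm Y ≤ 2 * g := by
  have hY := specNorm_nonneg Y
  suffices h : specNorm Y ≤ 3 / 2 * g + specNorm Y / 4 by linarith
  refine specNorm_le (by positivity) fun w => ?_
  obtain ⟨x, rfl⟩ := mulVec_surjective_iff_isUnit.2 hR w
  have hresidual :
      g * l2Norm (A *ᵥ x - Y *ᵥ (R *ᵥ x)) ≤ g * (specNorm Y / 4 * l2Norm (R *ᵥ x)) := by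
    linarith [hres x, mul_le_mul_of_nonneg_left (hlow x) hY]
  have htriangle := l2Norm_le_add_sub (Y *ᵥ (R *ᵥ x)) (A *ᵥ x)
  rw [l2Norm_sub_comm] at htriangle
  linarith [hlow x, le_of_mul_le_mul_left hresidual hg]

theorem l2Norm_le_mul_l2Norm_mulVec (hg : 0 < g) (hR : IsUnit R) (hκ : 0 ≤ κ)
    (hup : ∀ x, 3 * g * l2Norm (R *ᵥ x) ≤ (3 * κ + 1) * l2Norm (A *ᵥ x))
    (hres : ∀ x, 3 * l2Norm (A *ᵥ x - Y *ᵥ (R *ᵥ x)) ≤ l2Norm (A *ᵥ x)) (w : Fin n → ℝ) :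
    l2Norm w ≤ (3 * κ + 1) / (2 * g) * l2Norm (Y *ᵥ w) := by
  obtain ⟨x, rfl⟩ := mulVec_surjective_iff_isUnit.2 hR w
  have hlower : 2 * l2Norm (A *ᵥ x) ≤ 3 * l2Norm (Y *ᵥ (R *ᵥ x)) := by
    linarith [hres x, l2Norm_le_add_sub (A *ᵥ x) (Y *ᵥ (R *ᵥ x))]
  have h := mul_le_mul_of_nonneg_left hlower (show 0 ≤ 3 * κ + 1 by positivity)
  rw [div_mul_eq_mul_div, le_div_iff₀' (by positivity)]
  linarith [hup x]

theorem linearIndependent_col_and_cond2_le (hg : 0 < g) (hκ : 1 ≤ κ) (hη : 0 ≤ η) (hR : IsUnit R)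
    (hA : LinearIndependent ℝ A.col)
    (hlow : ∀ x, 2 * l2Norm (A *ᵥ x) ≤ 3 * g * l2Norm (R *ᵥ x))
    (hup : ∀ x, 3 * g * l2Norm (R *ᵥ x) ≤ (3 * κ + 1) * l2Norm (A *ᵥ x))
    (hres : specNorm (A - Y * R) ≤ η * (specNorm Y * specNorm R))
    (hsmall : 8 * η * κ * cond2 A ≤ 1) :
    LinearIndependent ℝ Y.col ∧ cond2 Y ≤ 3 * κ + 1 := by
  have hresidual := l2Norm_residual_le hg hκ hη hA hup hres hsmall
  have hY := specNorm_le_two_mul hg hR hlow hresidual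
  have hbelow := l2Norm_le_mul_l2Norm_mulVec (Y := Y) hg hR (zero_le_one.trans hκ) hup fun x => by
    refine le_of_mul_le_mul_left ?_ (mul_pos two_pos hg)
    linarith [hresidual x, mul_le_mul_of_nonneg_right hY (l2Norm_nonneg (A *ᵥ x))]
  have hbound : 0 ≤ (3 * κ + 1) / (2 * g) := by positivity
  refine ⟨linearIndependent_col_of_l2Norm_le hbelow, ?_⟩
  calc cond2 Y ≤ 2 * g * ((3 * κ + 1) / (2 * g)) :=
        mul_le_mul hY (specNorm_pinv_le hbound hbelow) (specNorm_nonneg _) (by positivity)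
    _ = 3 * κ + 1 := by field_simp

end conditioning

/-! ### The error constant -/

section C1

variable {c m s n : ℕ} {u : ℝ}

theorem C1_nonneg (hu₀ : 0 ≤ u) (hm : m * u < 1) (hk : (c * s * n : ℕ) * u < 1) :
    0 ≤ C1 c u m s n := by
  have := gam_nonneg hu₀ hm
  have := gam_nonneg hu₀ hk
  unfold C1
  positivity

theorem sqrt_mul_gam_le_C1 (hu₀ : 0 ≤ u) (hm : m * u < 1) (hk : (c * s * n : ℕ) * u < 1) :
    √n * gam u (c * s * n) ≤ C1 c u m s n := by
  have hα : 0 ≤ √((s : ℝ) * n) * gam u m := mul_nonneg (Real.sqrt_nonneg _) (gam_nonneg hu₀ hm)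
  have hβ : 0 ≤ √(n : ℝ) * gam u (c * s * n) :=
    mul_nonneg (Real.sqrt_nonneg _) (gam_nonneg hu₀ hk)
  unfold C1
  linarith [mul_nonneg hβ hα]

theorem gam_le_C1 (hn : 0 < n) (hu₀ : 0 ≤ u) (hm : m * u < 1) (hk : (c * s * n : ℕ) * u < 1) :
    gam u (c * s * n) ≤ C1 c u m s n := by
  refine le_trans ?_ (sqrt_mul_gam_le_C1 hu₀ hm hk)
  exact le_mul_of_one_le_left (gam_nonneg hu₀ hk) (Real.one_le_sqrt.2 (by exact_mod_cast hn))

theorem C1_le (hc : 0 < c) (hs : 0 < s) (hn : 0 < n) (hu₀ : 0 ≤ u) (hm : m * u < 1)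
    (hk : (c * s * n : ℕ) * u < 1) (h : C1 c u m s n ≤ 1 / 3) :
    C1 c u m s n ≤ 2 * c * ((√((s : ℝ) * n) * m + s * (n : ℝ) ^ (3 / 2 : ℝ)) * u) := by
  have hα₀ := gam_nonneg hu₀ hm
  have hβ₀ := gam_nonneg hu₀ hk
  have hαle : √((s : ℝ) * n) * gam u m ≤ 1 / 3 := by
    have : 0 ≤ √(n : ℝ) * gam u (c * s * n) * (1 + √((s : ℝ) * n) * gam u m) := by positivity
    unfold C1 at h
    linarith
  have hsqrt : 1 ≤ √((s : ℝ) * n) := Real.one_le_sqrt.2 (by exact_mod_cast Nat.mul_pos hs hn)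
  have hγm : gam u m ≤ 4 / 3 * (m * u) := gam_le_of_gam_le_third hu₀ hm <|
    (le_mul_of_one_le_left hα₀ hsqrt).trans hαle
  have hγc : gam u (c * s * n) ≤ 4 / 3 * ((c * s * n : ℕ) * u) :=
    gam_le_of_gam_le_third hu₀ hk ((gam_le_C1 hn hu₀ hm hk).trans h)
  have hpow : (n : ℝ) ^ (3 / 2 : ℝ) = n * √n := by
    rw [Real.sqrt_eq_rpow, ← Real.rpow_one_add' n.cast_nonneg (by norm_num)]
    norm_num
  have hc' : (1 : ℝ) ≤ c := by exact_mod_cast hc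
  calc C1 c u m s n
      ≤ √((s : ℝ) * n) * (4 / 3 * (m * u)) +
          √n * (4 / 3 * ((c * s * n : ℕ) * u)) * (1 + 1 / 3) := by
        unfold C1
        gcongr
    _ = 4 / 3 * (√((s : ℝ) * n) * m * u) + 16 / 9 * (c * (s * (n * √n) * u)) := by
        push_cast
        ring
    _ ≤ 2 * (c * (√((s : ℝ) * n) * m * u)) + 2 * (c * (s * (n * √n) * u)) := by
        gcongr ?_ * ?_ + ?_ * _
        · norm_num
        · exact le_mul_of_one_le_left (by positivity) hc'
        · norm_num
    _ = 2 * c * ((√((s : ℝ) * n) * m + s * (n : ℝ) ^ (3 / 2 : ℝ)) * u) := by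
        rw [hpow]
        ring

theorem eight_mul_gam_le_C1 (hc : 16 ≤ c) (hn : 0 < n) (hns : n ≤ s) (hu₀ : 0 ≤ u)
    (hm : m * u < 1) (hk : (c * s * n : ℕ) * u < 1) :
    8 * (n * gam u (2 * n)) ≤ C1 c u m s n := by
  have hle : 8 * n * (2 * n) ≤ c * s * n :=
    calc 8 * n * (2 * n) = 16 * n * n := by ring
      _ ≤ c * s * n := by gcongr
  have hsmall : (8 * n * (2 * n) : ℕ) * u < 1 := by
    refine lt_of_le_of_lt ?_ hk
    gcongr
  calc 8 * (n * gam u (2 * n)) = (8 * n : ℕ) * gam u (2 * n) := by push_cast; ring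
    _ ≤ gam u (8 * n * (2 * n)) := mul_gam_le hu₀ hsmall
    _ ≤ gam u (c * s * n) := gam_mono hu₀ hle hk
    _ ≤ C1 c u m s n := gam_le_C1 hn hu₀ hm hk

end C1

/-! ### The computed triangular factor -/

section sketch

variable {c m s n : ℕ} {u : ℝ} {A : Matrix (Fin m) (Fin n) ℝ} {S : Matrix (Fin s) (Fin m) ℝ}
  {B : Matrix (Fin s) (Fin n) ℝ} {R : Matrix (Fin n) (Fin n) ℝ} {hns : n ≤ s}

theorem FlMul.specNorm_sub_le (hu₀ : 0 ≤ u) (hu : u < 1) (hm : m * u < 1) (h : FlMul u S A B) :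
    specNorm (B - S * A) ≤ √((s : ℝ) * n) * gam u m * (specNorm S * specNorm A) :=
  calc specNorm (B - S * A) ≤ gam u m * (frobNorm S * frobNorm A) :=
        (specNorm_le_frobNorm _).trans (h.frobNorm_sub_le hu₀ hu hm)
    _ ≤ gam u m * (√s * specNorm S * (√n * specNorm A)) := by
        have := gam_nonneg hu₀ hm
        have := frobNorm_nonneg A
        have := specNorm_nonneg S
        gcongr
        · exact frobNorm_le_sqrt_mul_specNorm' S
        · exact frobNorm_le_sqrt_mul_specNorm A
    _ = √((s : ℝ) * n) * gam u m * (specNorm S * specNorm A) := by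
        rw [Real.sqrt_mul s.cast_nonneg]
        ring

theorem FlMul.specNorm_le (hu₀ : 0 ≤ u) (hu : u < 1) (hm : m * u < 1) (h : FlMul u S A B) :
    specNorm B ≤ (1 + √((s : ℝ) * n) * gam u m) * (specNorm S * specNorm A) := by
  have htriangle := specNorm_add_le (B - S * A) (S * A)
  rw [sub_add_cancel] at htriangle
  linarith [h.specNorm_sub_le hu₀ hu hm, specNorm_mul_le S A]

theorem FlHouseholderR.exists_sketch_perturbation (hc : 51 ≤ c) (hn : 0 < n) (hu₀ : 0 ≤ u)
    (hu : u < 1) (hm : m * u < 1) (hk : (c * s * n : ℕ) * u < 1) (hB : FlMul u S A B)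
    (hR : FlHouseholderR u hns B R) :
    ∃ E : Matrix (Fin s) (Fin n) ℝ, Rᵀ * R = (S * A + E)ᵀ * (S * A + E) ∧
      specNorm E ≤ C1 c u m s n * (specNorm S * specNorm A) := by
  obtain ⟨E, hRE, hE⟩ := hR.exists_backward_error hc hn hu₀ hk
  have hk₀ := gam_nonneg hu₀ hk
  have hE' : specNorm E ≤ √n * gam u (c * s * n) *
      ((1 + √((s : ℝ) * n) * gam u m) * (specNorm S * specNorm A)) :=
    calc specNorm E ≤ gam u (c * s * n) * (√n * specNorm B) :=
          (specNorm_le_frobNorm E).trans <| hE.trans <|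
            mul_le_mul_of_nonneg_left (frobNorm_le_sqrt_mul_specNorm B) hk₀
      _ = √n * gam u (c * s * n) * specNorm B := by ring
      _ ≤ _ := mul_le_mul_of_nonneg_left (hB.specNorm_le hu₀ hu hm) (by positivity)
  refine ⟨B - S * A + E, ?_, ?_⟩
  · rwa [← add_assoc, add_sub_cancel]
  · refine (specNorm_add_le _ _).trans ((add_le_add (hB.specNorm_sub_le hu₀ hu hm) hE').trans_eq ?_)
    unfold C1
    ring

theorem FlHouseholderR.l2Norm_mulVec_bounds {Q : Matrix (Fin m) (Fin n) ℝ}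
    {T : Matrix (Fin n) (Fin n) ℝ} (hc : 51 ≤ c) (hn : 0 < n) (hu₀ : 0 ≤ u) (hu : u < 1)
    (hm : m * u < 1) (hk : (c * s * n : ℕ) * u < 1) (hA : A = Q * T) (hQ : Qᵀ * Q = 1)
    (hAcol : LinearIndependent ℝ A.col) (hSQ : LinearIndependent ℝ (S * Q).col)
    (hκ : 3 * (C1 c u m s n * kS S Q * cond2 A) ≤ 1) (hB : FlMul u S A B)
    (hR : FlHouseholderR u hns B R) (x : Fin n → ℝ) :
    2 * l2Norm (A *ᵥ x) ≤ 3 * specNorm (pinv (S * Q)) * l2Norm (R *ᵥ x) ∧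
      3 * specNorm (pinv (S * Q)) * l2Norm (R *ᵥ x) ≤
        (3 * cond2 (S * Q) + 1) * l2Norm (A *ᵥ x) := by
  obtain ⟨E, hRE, hE⟩ := hR.exists_sketch_perturbation hc hn hu₀ hu hm hk hB
  have hδ : 3 * (specNorm (pinv (S * Q)) * (C1 c u m s n * (specNorm S * specNorm A)) *
      specNorm (pinv A)) ≤ 1 := hκ.trans_eq' (by rw [kS, cond2]; ring)
  subst hA
  have hg := specNorm_nonneg (pinv (S * Q))
  have hEx := l2Norm_mulVec_perturbation_le hg hAcol hE hδ
  exact ⟨two_mul_l2Norm_mulVec_le hg (l2Norm_mulVec_le_specNorm_pinv_mul hQ hSQ) hEx hRE x,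
    three_mul_l2Norm_mulVec_le hg (specNorm_pinv_mul_l2Norm_mulVec_le hQ) hEx hRE x⟩

end sketch

end SketchApply

open SketchApply in
theorem mainTheorem1_general {c m s n : ℕ} (hc : 51 ≤ c) (hn : 0 < n) (hns : n ≤ s) {u : ℝ}
    (hu₀ : 0 ≤ u) (hm : (m : ℝ) * u < 1) (hk : (c : ℝ) * s * n * u < 1)
    {A QA Yhat : Matrix (Fin m) (Fin n) ℝ} {S : Matrix (Fin s) (Fin m) ℝ}
    {RA Rhat : Matrix (Fin n) (Fin n) ℝ} {Bhat : Matrix (Fin s) (Fin n) ℝ}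
    (hSA : LinearIndependent ℝ (S * A).col) (hA : A = QA * RA) (hQ : QAᵀ * QA = 1)
    (hκ : 3 * (C1 c u m s n * kS S QA * cond2 A) ≤ 1) (hB : FlMul u S A Bhat)
    (hR : FlHouseholderR u hns Bhat Rhat) (hY : FlRightSolve u A Rhat Yhat) :
    C1 c u m s n ≤ 2 * c * ((√((s : ℝ) * n) * m + s * (n : ℝ) ^ (3 / 2 : ℝ)) * u) ∧
      (∀ i, Rhat i i ≠ 0) ∧ LinearIndependent ℝ Yhat.col ∧
        cond2 Yhat ≤ 3 * cond2 (S * QA) + 1 := by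
  have hk' : (c * s * n : ℕ) * u < 1 := by exact_mod_cast hk
  have hs := hn.trans_le hns
  have hcount : 2 * n ≤ c * s * n := Nat.mul_le_mul_right n (by nlinarith)
  have hn' : (2 * n : ℕ) * u < 1 := lt_of_le_of_lt (by gcongr) hk'
  have hu : u < 1 :=
    (le_mul_of_one_le_left hu₀ (by exact_mod_cast (by lia : 1 ≤ 2 * n))).trans_lt hn'
  have hAcol : LinearIndependent ℝ A.col := linearIndependent_col_of_mul_right hSA
  have hSQ : LinearIndependent ℝ (S * QA).col :=
    linearIndependent_col_of_mul_left (T := RA) (by rwa [Matrix.mul_assoc, ← hA])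
  have hκA : 1 ≤ cond2 A := one_le_cond2 hn hAcol
  have hκSQ : 1 ≤ cond2 (S * QA) := one_le_cond2 hn hSQ
  have hg : 0 < specNorm (pinv (S * QA)) := specNorm_pinv_pos hn hSQ
  have hbounds := hR.l2Norm_mulVec_bounds hc hn hu₀ hu hm hk' hA hQ hAcol hSQ hκ hB
  have hRcol : LinearIndependent ℝ Rhat.col :=
    linearIndependent_col_of_l2Norm_mulVec_le (C := 3 / 2 * specNorm (pinv (S * QA))) hAcol
      fun x => by linarith [(hbounds x).1]
  have hRtri := hR.isUpperTriangular hu₀ hu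
  have hdiag := apply_self_ne_zero_of_isUpperTriangular hRtri hRcol
  have hkS := cond2_le_kS S hQ
  have hC1₀ := C1_nonneg (s := s) hu₀ hm hk'
  have hC1 : C1 c u m s n ≤ 1 / 3 := by
    have := one_le_mul_of_one_le_of_one_le (hκSQ.trans hkS) hκA
    linarith [mul_le_mul_of_nonneg_left this hC1₀]
  have hsmall : 8 * (n * gam u (2 * n)) * cond2 (S * QA) * cond2 A ≤ 1 :=
    calc 8 * (n * gam u (2 * n)) * cond2 (S * QA) * cond2 A
        ≤ C1 c u m s n * kS S QA * cond2 A := by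
          gcongr
          exact eight_mul_gam_le_C1 (by lia) hn hns hu₀ hm hk'
      _ ≤ 1 := by linarith
  exact ⟨C1_le (by lia) hs hn hu₀ hm hk' hC1, hdiag,
    linearIndependent_col_and_cond2_le hg hκSQ
      (mul_nonneg n.cast_nonneg (gam_nonneg hu₀ hn')) (isUnit_of_linearIndependent_col hRcol) hAcol
      (fun x => (hbounds x).1) (fun x => (hbounds x).2)
      (hY.specNorm_sub_le hu₀ hu hn' hRtri hdiag) hsmall⟩

open SketchApply in
theorem mainTheorem1 :
    ∃ (c : ℕ) (K : ℝ), 0 < c ∧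
      ∀ (m s n : ℕ) (_hsm : s < m) (hns : n < s) (u : ℝ)
        (A : Matrix (Fin m) (Fin n) ℝ) (S : Matrix (Fin s) (Fin m) ℝ)
        (QA : Matrix (Fin m) (Fin n) ℝ) (RA : Matrix (Fin n) (Fin n) ℝ)
        (Bhat : Matrix (Fin s) (Fin n) ℝ) (Rhat : Matrix (Fin n) (Fin n) ℝ)
        (Yhat : Matrix (Fin m) (Fin n) ℝ),
        -- the unit round-off, for which `γ_m` and `γ̃_{sn}` make sense
        0 < u → (m : ℝ) * u < 1 → (c : ℝ) * s * n * u < 1 →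
        -- `A` and `SA` have full column rank, `S` has full row rank
        LinearIndependent ℝ A.col →
        LinearIndependent ℝ S.row →
        LinearIndependent ℝ (S * A).col →
        -- economized QR factorization `A = Q_A R_A`
        A = QA * RA → QA.transpose * QA = 1 → RA.BlockTriangular id →
        -- quantitative assumptions
        cond2 (S * QA) < 49 →
        (n : ℝ) ^ 2 * u < 1 / 201 →
        (m : ℝ) / n + √(n : ℝ) > 200 →
        cond2 A < 1 / (3 * C1 c u m s n * kS S QA) →
        -- the three steps in floating point
        FlMul u S A Bhat →
        FlHouseholderR u hns.le Bhat Rhat →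
        FlRightSolve u A Rhat Yhat →
        C1 c u m s n ≤ K * ((√((s : ℝ) * n) * m + s * (n : ℝ) ^ (3 / 2 : ℝ)) * u) ∧
        (∀ i, Rhat i i ≠ 0) ∧
        LinearIndependent ℝ Yhat.col ∧
        cond2 Yhat ≤ 4 * cond2 (S * QA) + 1 := by
  refine ⟨51, 2 * (51 : ℕ), by norm_num, ?_⟩
  intro m s n _ hns u A S QA RA B R Y hu hm hk _ _ hSA hA hQ _ _ _ hmn hκ hB hR hY
  have hn : 0 < n := n.pos_of_ne_zero fun h => by norm_num [h] at hmn
  have hpos : 0 < 3 * C1 51 u m s n * kS S QA :=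
    one_div_pos.1 ((cond2_nonneg A).trans_lt hκ)
  rw [lt_div_iff₀' hpos] at hκ
  obtain ⟨hC1, hdiag, hcol, hcond⟩ :=
    mainTheorem1_general le_rfl hn hns.le hu.le hm hk hSA hA hQ (by linarith) hB hR hY
  exact ⟨hC1, hdiag, hcol, by linarith [cond2_nonneg (S * QA)]⟩
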